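/- **Theorem (Existence of Optimal Controls).** Let $(\Theta,d)$ be a metric space with a Borel probability measure $\mu$, let $T>0$, $1<q<\infty$, $n,k\in\mathbb{N}$, $\alpha>0$, and let $\mathcal{U}\subseteq L^q([0,T],\mathbb{R}^k)$ be non-empty and weakly closed. Assume the following. 1. (Vector fields) $F=(F_1,\dots,F_k)\colon\mathbb{R}^n\times\Theta\to(\mathbb{R}^n)^k$ is Borel measurable and there are $L,C>0$ such that for $\mu$-a.e. $\theta$, $|F_i(x_1,\theta)-F_i(x_2,\theta)|\le L|x_1-x_2|$ and $|F_i(0,\theta)|\le C$ for all $i$ and all $x_1,x_2\in\mathbb{R}^n$. 2. (Initial data) $x_0\in L^{p_0}_\mu(\Theta,\mathbb{R}^n)$ with $4<p_0<\infty$; moreover $2<p_1\le p_0/2$, and $p_1'=p_1/(p_1-1)$. 3. (Integrand) $\nu$ is a finite positive Radon measure on $[0,T]$ and $a\colon[0,T]\times\mathbb{R}^n\times\Theta\to\mathbb{R}$ satisfies: there is $c_a\in\mathbb{R}$ such that for $\mu$-a.e. $\theta$, $a(t,x,\theta)\ge c_a$ for all $(t,x)$; for $\mu$-a.e. $\theta$,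 $a(\cdot,\cdot,\theta)$ is continuous, $a(t,\cdot,\theta)$ is differentiable for every $t$, and $D_xa(\cdot,\cdot,\theta)$ is continuous; for every $(t,x)$, $a(t,x,\cdot)$ and $D_xa(t,x,\cdot)$ are $\mu$-measurable; there are $C^{\mathrm{Lip}},C^{\mathrm{Lip}}_{\mathrm{der}}>0$ and non-negative $g^{\mathrm{Lip}}\in L^{p_1'}_\mu(\Theta)$, $g^{\mathrm{Lip}}_{\mathrm{der}}\in L^{p_1/(p_1-2)}_\mu(\Theta)$ such that, for $\mu$-a.e. $\theta$ and all $t,x,y$, $$|a(t,x,\theta)-a(t,y,\theta)|\le\big(C^{\mathrm{Lip}}(|x|^{p_1-1}+|y|^{p_1-1})+2g^{\mathrm{Lip}}(\theta)\big)|x-y|,$$ $$|D_xa(t,x,\theta)-D_xa(t,y,\theta)|\le\big(C^{\mathrm{Lip}}_{\mathrm{der}}(|x|^{p_1-2}+|y|^{p_1-2})+2g^{\mathrm{Lip}}_{\mathrm{der}}(\theta)\big)|x-y|;$$ and $\sup_{t\in[0,T]}|a(t,0,\cdot)|\in L^1_\mu(\Theta)$, $\sup_{t\in[0,T]}|D_xa(t,0,\cdot)|\in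 L^{p_1'}_\mu(\Theta)$. 4. (Risk measure) $\mathcal{R}\colon L^1_\mu(\Theta)\to(-\infty,+\infty]$ is proper, convex, monotone ($W_1\ge W_2$ $\mu$-a.e. implies $\mathcal{R}(W_1)\ge\mathcal{R}(W_2)$), finite on constants, lower semicontinuous for the $L^1_\mu$-norm, and $\mathrm{int}\{\mathcal{R}<+\infty\}\ne\emptyset$. 5. (Control cost) $f\colon[0,T]\times\mathbb{R}^k\to\mathbb{R}$ is such that $f(\cdot,v)$ is measurable for every $v$, $f(t,\cdot)$ is continuous and convex for a.e. $t$, there are $C',C''>0$ and non-negative $g^-,h\in L^1([0,T])$ with $C'|v|^q-g^-(t)\le f(t,v)\le h(t)+C''|v|^q$ for a.e. $t$ and all $v$, and there are $v'\in\mathbb{R}^k$ and a non-negative $g^+\in L^1([0,T])$ with $|f(t,v')|\le g^+(t)$ for a.e. $t$. For $u\in L^q([0,T],\mathbb{R}^k)$ let $x_u^\theta$ be the absolutely continuous solution on $[0,T]$ of $\dot x(t)=\sum_{i=1}^k u_i(t)F_i(x(t),\theta)$ for a.e. $t$, $x(0)=x_0(\theta)$, and put $$\mathcal{J}_u(\theta)=\int_{[0,T]}a\big(t,x_u^\theta(t),\theta\big)\,\mathrm{d}\nu(t),\qquad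 \rho(u)=\int_{[0,T]}f(t,u(t))\,\mathrm{d}t,\qquad \mathcal{I}(u)=\mathcal{R}(\mathcal{J}_u)+\alpha\rho(u).$$ Then these objects are well defined: for $\mu$-a.e. $\theta$ and every $u\in L^q([0,T],\mathbb{R}^k)$ the solution $x_u^\theta$ exists and is unique on $[0,T]$ and $t\mapsto a(t,x_u^\theta(t),\theta)$ is $\nu$-integrable on $[0,T]$; and for every such $u$, $\mathcal{J}_u\in L^1_\mu(\Theta)$ and $f(\cdot,u(\cdot))\in L^1([0,T])$. Moreover, there exists $u^\star\in\mathcal{U}$ such that $\mathcal{I}(u^\star)=\inf_{\mathcal{U}}\mathcal{I}$, where $\mathcal{I}$ takes values in $\mathbb{R}\cup\{+\infty\}$. -/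

import Mathlib

open MeasureTheory Set
open scoped ENNReal

noncomputable section

/-- The space `L^q([0,T], ℝ^k)` of controls. -/
abbrev ControlSpace (T : ℝ) (k : ℕ) (q : ℝ≥0∞) : Type :=
  Lp (EuclideanSpace ℝ (Fin k)) q (volume.restrict (Icc (0 : ℝ) T))

/-- A set of controls is weakly closed if it is closed in the weak topology of `L^q`. -/
def IsWeaklyClosed {T : ℝ} {k : ℕ} {q : ℝ≥0∞} [Fact (1 ≤ q)] (U : Set (ControlSpace T k q)) :
    Prop :=
  IsClosed (toWeakSpace ℝ (ControlSpace T k q) '' U)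

/-- The vector fields `F = (F₁, …, F_k)` are jointly Borel measurable, Lipschitz in the state with a
constant that does not depend on the parameter, and essentially bounded at the origin. -/
structure IsAdmissibleField {n k : ℕ} {Θ : Type*} [MeasurableSpace Θ] (μ : Measure Θ)
    (F : Fin k → EuclideanSpace ℝ (Fin n) → Θ → EuclideanSpace ℝ (Fin n)) : Prop where
  measurable : ∀ i, Measurable (fun z : EuclideanSpace ℝ (Fin n) × Θ => F i z.1 z.2)
  lipschitz : ∃ L : ℝ, 0 < L ∧ ∀ᵐ θ ∂μ, ∀ i x₁ x₂, ‖F i x₁ θ - F i x₂ θ‖ ≤ L * ‖x₁ - x₂‖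
  bounded : ∃ C : ℝ, 0 < C ∧ ∀ᵐ θ ∂μ, ∀ i, ‖F i 0 θ‖ ≤ C

/-- `x` is a (Carathéodory) solution on `[0,T]` of the Cauchy problem
`ẋ(t) = ∑ i, u i (t) F i (x(t), θ)`, `x(0) = x₀(θ)`. -/
structure IsTrajectory {n k : ℕ} {Θ : Type*} (T : ℝ)
    (F : Fin k → EuclideanSpace ℝ (Fin n) → Θ → EuclideanSpace ℝ (Fin n))
    (x₀ : Θ → EuclideanSpace ℝ (Fin n)) (u : ℝ → EuclideanSpace ℝ (Fin k)) (θ : Θ)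
    (x : ℝ → EuclideanSpace ℝ (Fin n)) : Prop where
  absolutelyContinuous : AbsolutelyContinuousOnInterval x 0 T
  hasDerivAt : ∀ᵐ t ∂(volume.restrict (Icc (0 : ℝ) T)),
    HasDerivAt x (∑ i, u t i • F i (x t) θ) t
  initial : x 0 = x₀ θ

open Classical in
/-- The trajectory `x_u^θ`, that is, the solution of the Cauchy problem with parameter `θ` and
control `u`. It exists and is unique on `[0,T]` for almost every `θ`; the value `0` is used for the
remaining parameters without a solution. -/
def trajectory {n k : ℕ} {Θ : Type*} (T : ℝ)
    (F : Fin k → EuclideanSpace ℝ (Fin n) → Θ → EuclideanSpace ℝ (Fin n))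
    (x₀ : Θ → EuclideanSpace ℝ (Fin n)) (u : ℝ → EuclideanSpace ℝ (Fin k)) (θ : Θ) :
    ℝ → EuclideanSpace ℝ (Fin n) :=
  if h : ∃ x, IsTrajectory T F x₀ u θ x then h.choose else 0

/-- Admissible integrands `a(t, x, θ)`, `t ∈ [0,T]`, for the exponent `p₁`. -/
structure IsAdmissibleIntegrand {n : ℕ} {Θ : Type*} [MeasurableSpace Θ] (μ : Measure Θ)
    (T p₁ : ℝ) (a : ℝ → EuclideanSpace ℝ (Fin n) → Θ → ℝ) : Prop where
  bddBelow : ∃ c : ℝ, ∀ᵐ θ ∂μ, ∀ t ∈ Icc 0 T, ∀ x, c ≤ a t x θ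
  continuousOn : ∀ᵐ θ ∂μ,
    ContinuousOn (fun z : ℝ × EuclideanSpace ℝ (Fin n) => a z.1 z.2 θ) (Icc 0 T ×ˢ univ)
  measurable : ∀ t ∈ Icc 0 T, ∀ x, AEStronglyMeasurable (fun θ => a t x θ) μ
  differentiable : ∀ᵐ θ ∂μ, ∀ t ∈ Icc 0 T, Differentiable ℝ (fun x => a t x θ)
  deriv_continuousOn : ∀ᵐ θ ∂μ,
    ContinuousOn (fun z : ℝ × EuclideanSpace ℝ (Fin n) => fderiv ℝ (fun x => a z.1 x θ) z.2)
      (Icc 0 T ×ˢ univ)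
  deriv_measurable : ∀ t ∈ Icc 0 T, ∀ x,
    AEStronglyMeasurable (fun θ => fderiv ℝ (fun y => a t y θ) x) μ
  lipschitz : ∃ (C : ℝ) (g : Θ → ℝ), 0 < C ∧ (∀ θ, 0 ≤ g θ) ∧
    MemLp g (ENNReal.ofReal (p₁ / (p₁ - 1))) μ ∧
    ∀ᵐ θ ∂μ, ∀ t ∈ Icc 0 T, ∀ x y,
      |a t x θ - a t y θ| ≤
        ((C * ‖x‖ ^ (p₁ - 1) + g θ) + (C * ‖y‖ ^ (p₁ - 1) + g θ)) * ‖x - y‖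
  integrable_zero : MemLp (fun θ => ⨆ t : Icc (0 : ℝ) T, |a t 0 θ|) 1 μ
  deriv_lipschitz : ∃ (C : ℝ) (g : Θ → ℝ), 0 < C ∧ (∀ θ, 0 ≤ g θ) ∧
    MemLp g (ENNReal.ofReal (p₁ / (p₁ - 2))) μ ∧
    ∀ᵐ θ ∂μ, ∀ t ∈ Icc 0 T, ∀ x y,
      ‖fderiv ℝ (fun z => a t z θ) x - fderiv ℝ (fun z => a t z θ) y‖ ≤
        ((C * ‖x‖ ^ (p₁ - 2) + g θ) + (C * ‖y‖ ^ (p₁ - 2) + g θ)) * ‖x - y‖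
  deriv_memLp_zero : MemLp (fun θ => ⨆ t : Icc (0 : ℝ) T, ‖fderiv ℝ (fun z => a t z θ) 0‖)
    (ENNReal.ofReal (p₁ / (p₁ - 1))) μ

/-- The random cost `𝒥_u(θ) = ∫_{[0,T]} a(t, x_u^θ(t), θ) dν(t)` as a function of `θ`. -/
def randomCost {n k : ℕ} {Θ : Type*} (T : ℝ)
    (F : Fin k → EuclideanSpace ℝ (Fin n) → Θ → EuclideanSpace ℝ (Fin n))
    (x₀ : Θ → EuclideanSpace ℝ (Fin n)) (ν : Measure ℝ)
    (a : ℝ → EuclideanSpace ℝ (Fin n) → Θ → ℝ) (u : ℝ → EuclideanSpace ℝ (Fin k)) (θ : Θ) : ℝ :=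
  ∫ t in Icc (0 : ℝ) T, a t (trajectory T F x₀ u θ t) θ ∂ν

open Classical in
/-- The random cost `𝒥_u` as an element of `L¹_μ(Θ)`. -/
def reducedCost {n k : ℕ} {Θ : Type*} [MeasurableSpace Θ] (μ : Measure Θ) (T : ℝ)
    (F : Fin k → EuclideanSpace ℝ (Fin n) → Θ → EuclideanSpace ℝ (Fin n))
    (x₀ : Θ → EuclideanSpace ℝ (Fin n)) (ν : Measure ℝ)
    (a : ℝ → EuclideanSpace ℝ (Fin n) → Θ → ℝ) (u : ℝ → EuclideanSpace ℝ (Fin k)) : Lp ℝ 1 μ :=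
  if h : MemLp (randomCost T F x₀ ν a u) 1 μ then h.toLp else 0

/-- Risk measures `ℛ : L¹_μ(Θ) → (-∞, +∞]`. -/
structure IsRiskMeasure {Θ : Type*} [MeasurableSpace Θ] (μ : Measure Θ) [IsFiniteMeasure μ]
    (R : Lp ℝ 1 μ → EReal) : Prop where
  ne_bot : ∀ W, R W ≠ ⊥
  proper : ∃ W, R W ≠ ⊤
  convex : ∀ (W₁ W₂ : Lp ℝ 1 μ) (r : ℝ), r ∈ Icc (0 : ℝ) 1 →
    R (r • W₁ + (1 - r) • W₂) ≤ (r : EReal) * R W₁ + ((1 - r : ℝ) : EReal) * R W₂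
  monotone : ∀ W₁ W₂ : Lp ℝ 1 μ, (∀ᵐ θ ∂μ, W₂ θ ≤ W₁ θ) → R W₂ ≤ R W₁
  const_lt_top : ∀ c : ℝ, R (Lp.const 1 μ c) < ⊤
  lowerSemicontinuous : LowerSemicontinuous R
  interior_domain : (interior {W | R W < ⊤}).Nonempty

/-- Integrands `f(t, v)`, `t ∈ [0,T]`, of the control cost, with growth of order `q`. -/
structure IsControlCost {k : ℕ} (T : ℝ) (q : ℝ≥0∞) (f : ℝ → EuclideanSpace ℝ (Fin k) → ℝ) :
    Prop where
  measurable : ∀ v, AEStronglyMeasurable (fun t => f t v) (volume.restrict (Icc (0 : ℝ) T))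
  continuous_convex : ∀ᵐ t ∂(volume.restrict (Icc (0 : ℝ) T)),
    Continuous (f t) ∧ ConvexOn ℝ univ (f t)
  coercive : ∃ (C : ℝ) (g : ℝ → ℝ), 0 < C ∧ IntegrableOn g (Icc 0 T) ∧ (∀ t, 0 ≤ g t) ∧
    ∀ᵐ t ∂(volume.restrict (Icc (0 : ℝ) T)), ∀ v, C * ‖v‖ ^ q.toReal - g t ≤ f t v
  integrable_point : ∃ (v : EuclideanSpace ℝ (Fin k)) (g : ℝ → ℝ), IntegrableOn g (Icc 0 T) ∧
    (∀ t, 0 ≤ g t) ∧ ∀ᵐ t ∂(volume.restrict (Icc (0 : ℝ) T)), |f t v| ≤ g t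
  growth : ∃ (C : ℝ) (h : ℝ → ℝ), 0 < C ∧ IntegrableOn h (Icc 0 T) ∧ (∀ t, 0 ≤ h t) ∧
    ∀ᵐ t ∂(volume.restrict (Icc (0 : ℝ) T)), ∀ v, f t v ≤ h t + C * ‖v‖ ^ q.toReal

/-- The control cost `ρ(u) = ∫_{[0,T]} f(t, u(t)) dt`. -/
def controlCost {k : ℕ} (T : ℝ) (f : ℝ → EuclideanSpace ℝ (Fin k) → ℝ)
    (u : ℝ → EuclideanSpace ℝ (Fin k)) : ℝ :=
  ∫ t in Icc (0 : ℝ) T, f t (u t)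

/-- The objective functional `ℐ(u) = ℛ(𝒥_u) + α ρ(u)`, with values in `ℝ ∪ {+∞}`. -/
def objective {n k : ℕ} {Θ : Type*} [MeasurableSpace Θ] (μ : Measure Θ) (T : ℝ)
    (F : Fin k → EuclideanSpace ℝ (Fin n) → Θ → EuclideanSpace ℝ (Fin n))
    (x₀ : Θ → EuclideanSpace ℝ (Fin n)) (ν : Measure ℝ)
    (a : ℝ → EuclideanSpace ℝ (Fin n) → Θ → ℝ) (R : Lp ℝ 1 μ → EReal)
    (f : ℝ → EuclideanSpace ℝ (Fin k) → ℝ) (α : ℝ) (u : ℝ → EuclideanSpace ℝ (Fin k)) : EReal :=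
  R (reducedCost μ T F x₀ ν a u) + ((α * controlCost T f u : ℝ) : EReal)

end

/-!
The proof is the direct method of the calculus of variations, in the weak topology of `L^q`.

*Coercivity.* The random cost is bounded below by a constant, so by monotonicity of the risk measure
the risk is bounded below by a real number, and the growth of the integrand of the control cost
bounds minimizing sequences in `L^q`.

*Compactness.* Functionals on `L^p` of a finite measure, `1 < p < ∞`, are represented by functions
in `L^{p'}` (`exists_lpPairing_eq`): the density of the signed measure `A ↦ ψ(1_A)` lies in `L^{p'}`
because its truncations have norm at most `‖ψ‖`. Using this once for `q'` and once for `q` turns the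
sequential Banach–Alaoglu theorem into weak sequential compactness of bounded sequences in `L^q`
(`exists_subseq_tendsto_dual`). The limit is admissible as the set of controls is weakly closed.

*Trajectories.* In the norm weighted by `exp (-2 ∫₀ᵗ κ)`, with `κ = k L |u|`, the Picard operator is
a contraction with constant `1 / 2` (`IsCaratheodoryField.norm_integral_sub_le`). This gives
existence, uniqueness, a bound linear in `|x₀(θ)|`, and stability under perturbations of the
integral equation (`IsCaratheodoryField.norm_sub_le_of_integral_eq`). If `u_j` tends weakly
to `v`, then the trajectory of `v` solves the equation with control `u_j` up to the error
`∫₀ᵗ ∑ᵢ (u_j - v)ᵢ Fᵢ(x_v)`, which tends to zero pointwise by weak convergence and uniformly by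
equicontinuity, because `q > 1`. So trajectories converge (`tendsto_trajectory`).

*Lower semicontinuity.* The growth conditions on the integrand and `x₀ ∈ L^{p₀}`, `p₁ ≤ p₀`, give an
integrable majorant of the random costs, so they converge in `L¹_μ` by dominated convergence
(`tendsto_reducedCost`), and the risk measure is lower semicontinuous for this convergence. Their
measurability in `θ` follows from that of the Picard iterates, since a Carathéodory function agrees
almost everywhere with a jointly measurable one (`exists_measurable_uncurry_of_continuous`). The
control cost is convex with closed sublevel sets, by Fatou's lemma, hence weakly lower
semicontinuous (`IsControlCost.eventually_lt_of_tendsto`).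
-/

/-! ### Absolutely continuous functions and primitives -/

section AbsolutelyContinuous

variable {X Y E : Type*} [PseudoMetricSpace X] [PseudoMetricSpace Y]
  [NormedAddCommGroup E] [NormedSpace ℝ E]

theorem AbsolutelyContinuousOnInterval.of_dist_le {f : ℝ → X} {g : ℝ → Y} {a b : ℝ}
    (hg : AbsolutelyContinuousOnInterval g a b)
    (h : ∀ s ∈ uIcc a b, ∀ t ∈ uIcc a b, dist (f s) (f t) ≤ dist (g s) (g t)) :
    AbsolutelyContinuousOnInterval f a b := by
  rw [absolutelyContinuousOnInterval_iff] at hg ⊢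
  intro ε hε
  obtain ⟨δ, hδ, H⟩ := hg ε hε
  refine ⟨δ, hδ, fun I hI hI' => lt_of_le_of_lt (Finset.sum_le_sum fun i hi => ?_) (H I hI hI')⟩
  exact h _ (hI.1 i hi).1 _ (hI.1 i hi).2

theorem LipschitzOnWith.comp_absolutelyContinuousOnInterval {φ : ℝ → X} {g : ℝ → ℝ}
    {K : NNReal} {s : Set ℝ} {a b : ℝ} (hφ : LipschitzOnWith K φ s)
    (hg : AbsolutelyContinuousOnInterval g a b) (hs : MapsTo g (uIcc a b) s) :
    AbsolutelyContinuousOnInterval (fun t => φ (g t)) a b := by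
  refine (hg.const_mul (K : ℝ)).of_dist_le fun t ht t' ht' => ?_
  refine (hφ.dist_le_mul _ (hs ht) _ (hs ht')).trans_eq ?_
  simp only [Real.dist_eq, ← mul_sub, abs_mul, NNReal.abs_eq]

theorem IntervalIntegrable.absolutelyContinuousOnInterval_primitive {f : ℝ → E}
    {a b : ℝ} (h : IntervalIntegrable f volume a b) :
    AbsolutelyContinuousOnInterval (fun t => ∫ s in a..t, f s) a b := by
  refine (h.norm.absolutelyContinuousOnInterval_intervalIntegral
    (c := a) left_mem_uIcc).of_dist_le fun s hs t ht => ?_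
  have hsub : ∀ r ∈ uIcc a b, IntervalIntegrable f volume a r := fun r hr =>
    h.mono_set (uIcc_subset_uIcc left_mem_uIcc hr)
  rw [dist_comm, dist_comm (∫ v in a..s, _), dist_eq_norm, Real.dist_eq,
    intervalIntegral.integral_interval_sub_left (hsub t ht) (hsub s hs),
    intervalIntegral.integral_interval_sub_left (hsub t ht).norm (hsub s hs).norm]
  exact intervalIntegral.norm_integral_le_abs_integral_norm

/-- An absolutely continuous function with values in a Banach space is the primitive of its
almost everywhere derivative, provided the derivative is integrable. -/
theorem AbsolutelyContinuousOnInterval.eq_add_integral [CompleteSpace E] {x f : ℝ → E} {a b : ℝ}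
    (hx : AbsolutelyContinuousOnInterval x a b) (hf : IntervalIntegrable f volume a b)
    (hd : ∀ᵐ t, t ∈ uIcc a b → HasDerivAt x (f t) t) :
    ∀ t ∈ uIcc a b, x t = x a + ∫ s in a..t, f s := by
  obtain ⟨C, hC⟩ := (hx.sub hf.absolutelyContinuousOnInterval_primitive).const_of_ae_hasDerivAt_zero
    (by
      filter_upwards [hd, hf.ae_hasDerivAt_integral] with t h1 h2 ht
      simpa using (h1 ht).sub (h2 ht a left_mem_uIcc))
  intro t ht
  have h1 := hC t ht
  have h2 := hC a left_mem_uIcc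
  simp only [Pi.sub_apply, intervalIntegral.integral_same, sub_zero] at h1 h2
  rw [h2, ← h1]; abel

end AbsolutelyContinuous

/-! ### A Gronwall inequality with integrable kernel -/

section Gronwall

variable {κ : ℝ → ℝ} {T : ℝ}

theorem intervalIntegrable_of_integrableOn_Icc {E : Type*} [NormedAddCommGroup E] {f : ℝ → E}
    (hf : IntegrableOn f (Icc 0 T)) {s t : ℝ} (hs : s ∈ Icc 0 T) (ht : t ∈ Icc 0 T) :
    IntervalIntegrable f volume s t :=
  (intervalIntegrable_iff' ).2 (hf.mono_set (by
    rw [uIcc_eq_union]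
    exact union_subset (Icc_subset_Icc hs.1 ht.2) (Icc_subset_Icc ht.1 hs.2)))

theorem primitive_nonneg (hκ0 : ∀ t ∈ Icc 0 T, 0 ≤ κ t) {t : ℝ} (ht : t ∈ Icc 0 T) :
    0 ≤ ∫ s in (0 : ℝ)..t, κ s :=
  intervalIntegral.integral_nonneg ht.1 fun s hs => hκ0 s ⟨hs.1, hs.2.trans ht.2⟩

theorem primitive_mono (hκ : IntegrableOn κ (Icc 0 T)) (hκ0 : ∀ t ∈ Icc 0 T, 0 ≤ κ t) {s t : ℝ}
    (hs : s ∈ Icc 0 T) (ht : t ∈ Icc 0 T) (hst : s ≤ t) :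
    ∫ r in (0 : ℝ)..s, κ r ≤ ∫ r in (0 : ℝ)..t, κ r := by
  have h0 : (0 : ℝ) ∈ Icc 0 T := ⟨le_rfl, hs.1.trans hs.2⟩
  rw [← sub_nonneg, intervalIntegral.integral_interval_sub_left
    (intervalIntegrable_of_integrableOn_Icc hκ h0 ht)
    (intervalIntegrable_of_integrableOn_Icc hκ h0 hs)]
  exact intervalIntegral.integral_nonneg hst fun r hr => hκ0 r ⟨hs.1.trans hr.1, hr.2.trans ht.2⟩

theorem continuousOn_primitive_zero {E : Type*} [NormedAddCommGroup E] [NormedSpace ℝ E]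
    {f : ℝ → E} (hf : IntegrableOn f (Icc 0 T)) :
    ContinuousOn (fun t => ∫ s in (0 : ℝ)..t, f s) (Icc 0 T) := by
  rcases le_or_gt 0 T with hT | hT
  · have := (intervalIntegrable_of_integrableOn_Icc hf ⟨le_rfl, hT⟩
      ⟨hT, le_rfl⟩).absolutelyContinuousOnInterval_primitive.continuousOn
    rwa [uIcc_of_le hT] at this
  · simp [Icc_eq_empty_of_lt hT]

/-- The weight `exp (2 ∫₀ᵗ κ)` turns the integral operator with kernel `κ` into a contraction with
constant `1 / 2`. -/
theorem integral_mul_exp_le (hκ : IntegrableOn κ (Icc 0 T)) {t : ℝ} (ht : t ∈ Icc 0 T) :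
    ∫ s in (0 : ℝ)..t, κ s * Real.exp (2 * ∫ r in (0 : ℝ)..s, κ r) ≤
      Real.exp (2 * ∫ r in (0 : ℝ)..t, κ r) / 2 := by
  have h0 : (0 : ℝ) ∈ Icc 0 T := ⟨le_rfl, ht.1.trans ht.2⟩
  have hi : IntervalIntegrable κ volume 0 t := intervalIntegrable_of_integrableOn_Icc hκ h0 ht
  have hac := hi.absolutelyContinuousOnInterval_primitive
  obtain ⟨B, hB⟩ := hac.exists_bound
  have hlip : ∃ K, LipschitzOnWith K (fun y : ℝ => Real.exp (2 * y)) (Icc (-B) B) :=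
    ContDiffOn.exists_lipschitzOnWith (n := 1) (by fun_prop) (by decide) (convex_Icc _ _)
      isCompact_Icc
  obtain ⟨K, hK⟩ := hlip
  have hG := hK.comp_absolutelyContinuousOnInterval hac
    (fun s hs => by simpa [abs_le] using hB s hs)
  have hder : ∀ᵐ s, s ∈ uIcc 0 t → HasDerivAt (fun t => Real.exp (2 * ∫ r in (0 : ℝ)..t, κ r))
      (2 * (κ s * Real.exp (2 * ∫ r in (0 : ℝ)..s, κ r))) s := by
    filter_upwards [hi.ae_hasDerivAt_integral] with s hs hst
    have := ((hs hst 0 left_mem_uIcc).const_mul 2).exp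
    convert this using 1; ring
  have key := hG.integral_deriv_eq_sub
  have : ∫ s in (0 : ℝ)..t, deriv (fun t => Real.exp (2 * ∫ r in (0 : ℝ)..t, κ r)) s =
      ∫ s in (0 : ℝ)..t, 2 * (κ s * Real.exp (2 * ∫ r in (0 : ℝ)..s, κ r)) := by
    refine intervalIntegral.integral_congr_ae ?_
    filter_upwards [hder] with s hs hst
    exact (hs (uIoc_subset_uIcc hst)).deriv
  rw [this, intervalIntegral.integral_const_mul] at key
  simp only [intervalIntegral.integral_same, mul_zero, Real.exp_zero] at key
  linarith

theorem integrableOn_mul_exp (hκ : IntegrableOn κ (Icc 0 T)) :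
    IntegrableOn (fun s => κ s * Real.exp (2 * ∫ r in (0 : ℝ)..s, κ r)) (Icc 0 T) :=
  hκ.mul_continuousOn (Real.continuous_exp.comp_continuousOn
    ((continuousOn_primitive_zero hκ).const_mul 2 |>.congr fun _ _ => rfl)) isCompact_Icc

/-- If `‖f‖ ≤ M κ exp (2 ∫ κ)` then the primitive of `f` is bounded by `M / 2 * exp (2 ∫ κ)`. -/
theorem norm_integral_le_weight {E : Type*} [NormedAddCommGroup E] [NormedSpace ℝ E] {f : ℝ → E}
    (hκ : IntegrableOn κ (Icc 0 T)) {M : ℝ} (hM : 0 ≤ M)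
    (hf : ∀ s ∈ Icc 0 T, ‖f s‖ ≤ κ s * (M * Real.exp (2 * ∫ r in (0 : ℝ)..s, κ r)))
    {t : ℝ} (ht : t ∈ Icc 0 T) :
    ‖∫ s in (0 : ℝ)..t, f s‖ ≤ M / 2 * Real.exp (2 * ∫ r in (0 : ℝ)..t, κ r) := by
  have h0 : (0 : ℝ) ∈ Icc 0 T := ⟨le_rfl, ht.1.trans ht.2⟩
  have h1 : ‖∫ s in (0 : ℝ)..t, f s‖ ≤
      ∫ s in (0 : ℝ)..t, M * (κ s * Real.exp (2 * ∫ r in (0 : ℝ)..s, κ r)) := by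
    refine intervalIntegral.norm_integral_le_of_norm_le ht.1 (Filter.Eventually.of_forall
      fun s hs => (hf s ⟨hs.1.le, hs.2.trans ht.2⟩).trans_eq (by ring))
      ((intervalIntegrable_of_integrableOn_Icc (integrableOn_mul_exp hκ) h0 ht).const_mul M)
  rw [intervalIntegral.integral_const_mul] at h1
  nlinarith [integral_mul_exp_le hκ ht]

/-- **Gronwall inequality** with an integrable kernel; the constants are not optimal. -/
theorem le_exp_of_le_integral_mul (hκ : IntegrableOn κ (Icc 0 T)) (hκ0 : ∀ t ∈ Icc 0 T, 0 ≤ κ t)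
    {φ : ℝ → ℝ} {δ : ℝ} (hδ : 0 ≤ δ) (hφ : ContinuousOn φ (Icc 0 T))
    (h : ∀ t ∈ Icc 0 T, φ t ≤ δ + ∫ s in (0 : ℝ)..t, κ s * φ s) :
    ∀ t ∈ Icc 0 T, φ t ≤ 2 * δ * Real.exp (2 * ∫ s in (0 : ℝ)..T, κ s) := by
  intro t ht
  have h0 : (0 : ℝ) ∈ Icc 0 T := ⟨le_rfl, ht.1.trans ht.2⟩
  set w : ℝ → ℝ := fun t => Real.exp (2 * ∫ r in (0 : ℝ)..t, κ r) with hw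
  have hwpos : ∀ t, 0 < w t := fun t => Real.exp_pos _
  have hwc : ContinuousOn w (Icc 0 T) := Real.continuous_exp.comp_continuousOn
    ((continuousOn_primitive_zero hκ).const_mul 2 |>.congr fun _ _ => rfl)
  obtain ⟨t₁, ht₁, hmax⟩ := isCompact_Icc.exists_isMaxOn ⟨t, ht⟩
    (hφ.div hwc fun s _ => (hwpos s).ne')
  -- `M` is the weighted supremum of `φ`; the hypothesis at a maximizer gives `M ≤ 2 δ`.
  set M := φ t₁ / w t₁ with hMdef
  have hle : ∀ s ∈ Icc 0 T, φ s ≤ M * w s := fun s hs => by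
    have := hmax hs
    simp only [mem_ofPred_eq, Pi.div_apply] at this
    rwa [div_le_iff₀ (hwpos s)] at this
  have hwT : w t ≤ w T := by
    refine Real.exp_le_exp.2 ?_
    have := primitive_mono hκ hκ0 ht ⟨h0.2, le_rfl⟩ ht.2
    linarith
  rcases le_or_gt M 0 with hM | hM
  · have := hle t ht
    have h1 := mul_nonpos_of_nonpos_of_nonneg hM (hwpos t).le
    have h2 : 0 ≤ 2 * δ * w T := by have := (hwpos T).le; positivity
    exact (this.trans h1).trans h2
  · have hMt : φ t₁ = M * w t₁ := by rw [hMdef, div_mul_cancel₀ _ (hwpos t₁).ne']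
    have hint : ∫ s in (0 : ℝ)..t₁, κ s * φ s ≤ M * (w t₁ / 2) := by
      refine le_trans ?_ (mul_le_mul_of_nonneg_left (integral_mul_exp_le hκ ht₁) hM.le)
      rw [← intervalIntegral.integral_const_mul]
      refine intervalIntegral.integral_mono_on ht₁.1
        (intervalIntegrable_of_integrableOn_Icc (hκ.mul_continuousOn hφ isCompact_Icc) h0 ht₁)
        ((intervalIntegrable_of_integrableOn_Icc (integrableOn_mul_exp hκ) h0 ht₁).const_mul M)
        fun s hs => ?_
      have hsT : s ∈ Icc 0 T := ⟨hs.1, hs.2.trans ht₁.2⟩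
      calc κ s * φ s ≤ κ s * (M * w s) := mul_le_mul_of_nonneg_left (hle s hsT) (hκ0 s hsT)
        _ = M * (κ s * w s) := by ring
    have h1 := h t₁ ht₁
    have hw1 : 1 ≤ w t₁ := Real.one_le_exp (by have := primitive_nonneg hκ0 ht₁; linarith)
    have hM2 : M ≤ 2 * δ := by nlinarith
    calc φ t ≤ M * w t := hle t ht
      _ ≤ 2 * δ * w T := mul_le_mul hM2 hwT (hwpos t).le (by linarith)

end Gronwall

/-! ### Carathéodory differential equations -/

/-- A time-dependent vector field `V` on `[0,T]` that is Lipschitz in the state with an integrable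
constant `κ(t)`, has size at most `c κ(t)` at the origin, and is measurable in time along
continuous curves. -/
structure IsCaratheodoryField {E : Type*} [NormedAddCommGroup E] (V : ℝ → E → E) (κ : ℝ → ℝ)
    (T c : ℝ) : Prop where
  integrableOn : IntegrableOn κ (Icc 0 T)
  nonneg : ∀ t ∈ Icc 0 T, 0 ≤ κ t
  const_nonneg : 0 ≤ c
  lipschitz : ∀ t ∈ Icc 0 T, ∀ x y, ‖V t x - V t y‖ ≤ κ t * ‖x - y‖
  bound : ∀ t ∈ Icc 0 T, ‖V t 0‖ ≤ κ t * c
  measurable : ∀ x : ℝ → E, ContinuousOn x (Icc 0 T) →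
    AEStronglyMeasurable (fun t => V t (x t)) (volume.restrict (Icc 0 T))

/-- The Picard iterates of the integral equation `x(t) = x₀ + ∫₀ᵗ V(s, x(s)) ds`, starting from the
constant `x₀`. -/
noncomputable def picardIterate {E : Type*} [NormedAddCommGroup E] [NormedSpace ℝ E]
    (V : ℝ → E → E) (x₀ : E) : ℕ → ℝ → E
  | 0 => fun _ => x₀
  | j + 1 => fun t => x₀ + ∫ s in (0 : ℝ)..t, V s (picardIterate V x₀ j s)

namespace IsCaratheodoryField

variable {E : Type*} [NormedAddCommGroup E] {V : ℝ → E → E} {κ : ℝ → ℝ} {T c : ℝ} {x₀ : E}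

theorem norm_le (hV : IsCaratheodoryField V κ T c) {t : ℝ} (ht : t ∈ Icc 0 T) (x : E) :
    ‖V t x‖ ≤ κ t * (c + ‖x‖) := by
  have h1 := hV.lipschitz t ht x 0
  have h2 := hV.bound t ht
  have h3 : ‖V t x‖ ≤ ‖V t x - V t 0‖ + ‖V t 0‖ := by
    simpa using norm_add_le (V t x - V t 0) (V t 0)
  rw [sub_zero] at h1
  linarith

theorem integrableOn_comp (hV : IsCaratheodoryField V κ T c) {x : ℝ → E}
    (hx : ContinuousOn x (Icc 0 T)) : IntegrableOn (fun t => V t (x t)) (Icc 0 T) := by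
  have h : IntegrableOn (fun t => κ t * (c + ‖x t‖)) (Icc 0 T) :=
    hV.integrableOn.mul_continuousOn (continuousOn_const.add hx.norm) isCompact_Icc
  refine Integrable.mono' h (hV.measurable x hx) ?_
  exact (ae_restrict_iff' measurableSet_Icc).2 (.of_forall fun t ht => hV.norm_le ht _)

variable [NormedSpace ℝ E]

/-- The Picard operator is a contraction for the weight `exp (2 ∫₀ᵗ κ)`. -/
theorem norm_integral_sub_le (hV : IsCaratheodoryField V κ T c) {x y : ℝ → E}
    (hx : ContinuousOn x (Icc 0 T)) (hy : ContinuousOn y (Icc 0 T)) {M : ℝ} (hM : 0 ≤ M)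
    (h : ∀ t ∈ Icc 0 T, ‖x t - y t‖ ≤ M * Real.exp (2 * ∫ r in (0 : ℝ)..t, κ r)) {t : ℝ}
    (ht : t ∈ Icc 0 T) :
    ‖(x₀ + ∫ s in (0 : ℝ)..t, V s (x s)) - (x₀ + ∫ s in (0 : ℝ)..t, V s (y s))‖ ≤
      M / 2 * Real.exp (2 * ∫ r in (0 : ℝ)..t, κ r) := by
  have h0 : (0 : ℝ) ∈ Icc 0 T := ⟨le_rfl, ht.1.trans ht.2⟩
  rw [add_sub_add_left_eq_sub, ← intervalIntegral.integral_sub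
    (intervalIntegrable_of_integrableOn_Icc (hV.integrableOn_comp hx) h0 ht)
    (intervalIntegrable_of_integrableOn_Icc (hV.integrableOn_comp hy) h0 ht)]
  refine norm_integral_le_weight hV.integrableOn hM (fun s hs => ?_) ht
  exact (hV.lipschitz s hs _ _).trans (mul_le_mul_of_nonneg_left (h s hs) (hV.nonneg s hs))

theorem continuousOn_picardIterate (hV : IsCaratheodoryField V κ T c) (x₀ : E) (j : ℕ) :
    ContinuousOn (picardIterate V x₀ j) (Icc 0 T) := by
  induction j with
  | zero => exact continuousOn_const
  | succ j ih =>
    exact continuousOn_const.add (continuousOn_primitive_zero (hV.integrableOn_comp ih))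

theorem norm_picardIterate_succ_sub_le (hV : IsCaratheodoryField V κ T c) (x₀ : E) (j : ℕ) :
    ∀ t ∈ Icc 0 T, ‖picardIterate V x₀ j t - picardIterate V x₀ (j + 1) t‖ ≤
      (c + ‖x₀‖) / 2 ^ j * Real.exp (2 * ∫ r in (0 : ℝ)..t, κ r) := by
  have hc := hV.const_nonneg
  induction j with
  | zero =>
    intro t ht
    have h1 : ‖∫ s in (0 : ℝ)..t, V s x₀‖ ≤
        (c + ‖x₀‖) / 2 * Real.exp (2 * ∫ r in (0 : ℝ)..t, κ r) := by
      refine norm_integral_le_weight hV.integrableOn (by positivity) (fun s hs => ?_) ht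
      refine (hV.norm_le hs x₀).trans (mul_le_mul_of_nonneg_left ?_ (hV.nonneg s hs))
      refine le_mul_of_one_le_right (by positivity) (Real.one_le_exp ?_)
      have := primitive_nonneg hV.nonneg hs
      linarith
    have h2 : (c + ‖x₀‖) / 2 * Real.exp (2 * ∫ r in (0 : ℝ)..t, κ r) ≤
        (c + ‖x₀‖) * Real.exp (2 * ∫ r in (0 : ℝ)..t, κ r) := by
      gcongr
      have : 0 ≤ c + ‖x₀‖ := by positivity
      linarith
    simpa [picardIterate] using h1.trans h2
  | succ j ih =>
    intro t ht
    have := hV.norm_integral_sub_le (x₀ := x₀) (hV.continuousOn_picardIterate x₀ j)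
      (hV.continuousOn_picardIterate x₀ (j + 1)) (by positivity) ih ht
    rwa [div_div, ← pow_succ] at this

/-- The Picard iterates converge on `[0,T]` to a solution of the integral equation; it is
continuous because the convergence is uniform. -/
theorem exists_integral_solution [CompleteSpace E] (hV : IsCaratheodoryField V κ T c) (x₀ : E) :
    ∃ x : ℝ → E, ContinuousOn x (Icc 0 T) ∧
      (∀ t ∈ Icc 0 T, Filter.Tendsto (fun j => picardIterate V x₀ j t) Filter.atTop (nhds (x t))) ∧
      ∀ t ∈ Icc 0 T, x t = x₀ + ∫ s in (0 : ℝ)..t, V s (x s) := by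
  have hc := hV.const_nonneg
  set w : ℝ → ℝ := fun t => Real.exp (2 * ∫ r in (0 : ℝ)..t, κ r) with hw
  have hdist : ∀ t ∈ Icc 0 T, ∀ j, dist (picardIterate V x₀ j t) (picardIterate V x₀ (j + 1) t) ≤
      (2 * (c + ‖x₀‖) * w t) / 2 / 2 ^ j := fun t ht j => by
    rw [dist_eq_norm]
    refine (hV.norm_picardIterate_succ_sub_le x₀ j t ht).trans_eq ?_
    rw [hw]; ring
  have hlim : ∀ t ∈ Icc 0 T, ∃ y, Filter.Tendsto (fun j => picardIterate V x₀ j t) Filter.atTop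
      (nhds y) := fun t ht =>
    cauchySeq_tendsto_of_complete (cauchySeq_of_le_geometric_two (hdist t ht))
  choose! x hx using hlim
  have hest : ∀ j, ∀ t ∈ Icc 0 T, ‖x t - picardIterate V x₀ j t‖ ≤
      (2 * (c + ‖x₀‖)) / 2 ^ j * w t := fun j t ht => by
    rw [← dist_eq_norm, dist_comm]
    refine (dist_le_of_le_geometric_two_of_tendsto (hdist t ht) (hx t ht) j).trans_eq ?_
    ring
  have hz : Filter.Tendsto (fun j : ℕ => (2 * (c + ‖x₀‖)) / 2 ^ j) Filter.atTop (nhds 0) := by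
    have := (tendsto_pow_atTop_nhds_zero_of_lt_one (r := (1 / 2 : ℝ)) (by norm_num)
      (by norm_num)).const_mul (2 * (c + ‖x₀‖))
    simpa [div_eq_mul_inv] using this
  have hxc : ContinuousOn x (Icc 0 T) := by
    have hunif : TendstoUniformlyOn (fun j => picardIterate V x₀ j) x Filter.atTop (Icc 0 T) := by
      rw [Metric.tendstoUniformlyOn_iff]
      intro ε hε
      have h1 := hz.mul_const (w T)
      rw [zero_mul] at h1
      filter_upwards [h1.eventually (gt_mem_nhds hε)] with j hj t ht
      rw [dist_eq_norm]
      refine lt_of_le_of_lt ((hest j t ht).trans ?_) hj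
      gcongr
      refine Real.exp_le_exp.2 ?_
      have := primitive_mono hV.integrableOn hV.nonneg ht ⟨ht.1.trans ht.2, le_rfl⟩ ht.2
      linarith
    exact hunif.continuousOn (Filter.Frequently.of_forall (hV.continuousOn_picardIterate x₀))
  refine ⟨x, hxc, hx, fun t ht => ?_⟩
  refine tendsto_nhds_unique ((hx t ht).comp (Filter.tendsto_add_atTop_nat 1)) ?_
  rw [tendsto_iff_norm_sub_tendsto_zero]
  refine squeeze_zero (fun _ => norm_nonneg _) (fun j => ?_)
    (show Filter.Tendsto (fun j : ℕ => (2 * (c + ‖x₀‖)) / 2 ^ j / 2 * w t) Filter.atTop (nhds 0) by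
      simpa using (hz.div_const 2).mul_const (w t))
  rw [norm_sub_rev]
  exact hV.norm_integral_sub_le hxc (hV.continuousOn_picardIterate x₀ j) (by positivity)
    (hest j) ht

theorem norm_le_of_integral_eq (hV : IsCaratheodoryField V κ T c) {x : ℝ → E}
    (hxc : ContinuousOn x (Icc 0 T))
    (hx : ∀ t ∈ Icc 0 T, x t = x₀ + ∫ s in (0 : ℝ)..t, V s (x s)) :
    ∀ t ∈ Icc 0 T, ‖x t‖ ≤ 2 * (c + ‖x₀‖) * Real.exp (2 * ∫ s in (0 : ℝ)..T, κ s) := by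
  have hc := hV.const_nonneg
  intro t ht
  have := le_exp_of_le_integral_mul hV.integrableOn hV.nonneg (φ := fun t => c + ‖x t‖)
    (δ := c + ‖x₀‖) (by positivity) (continuousOn_const.add hxc.norm) (fun t ht => ?_) t ht
  · linarith
  have h0 : (0 : ℝ) ∈ Icc 0 T := ⟨le_rfl, ht.1.trans ht.2⟩
  have h1 : ‖∫ s in (0 : ℝ)..t, V s (x s)‖ ≤ ∫ s in (0 : ℝ)..t, κ s * (c + ‖x s‖) :=
    intervalIntegral.norm_integral_le_of_norm_le ht.1 (.of_forall fun s hs =>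
      hV.norm_le ⟨hs.1.le, hs.2.trans ht.2⟩ _)
      (intervalIntegrable_of_integrableOn_Icc (hV.integrableOn.mul_continuousOn
        (continuousOn_const.add hxc.norm) isCompact_Icc) h0 ht)
  have h2 : ‖x t‖ ≤ ‖x₀‖ + ‖∫ s in (0 : ℝ)..t, V s (x s)‖ := by
    conv_lhs => rw [hx t ht]
    exact norm_add_le _ _
  linarith

/-- Stability: a curve that solves the integral equation up to an error at most `δ` stays close to
the exact solution. -/
theorem norm_sub_le_of_integral_eq (hV : IsCaratheodoryField V κ T c) {x y : ℝ → E} {δ : ℝ}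
    (hδ : 0 ≤ δ) (hxc : ContinuousOn x (Icc 0 T)) (hyc : ContinuousOn y (Icc 0 T))
    (hx : ∀ t ∈ Icc 0 T, x t = x₀ + ∫ s in (0 : ℝ)..t, V s (x s))
    (hy : ∀ t ∈ Icc 0 T, ‖y t - (x₀ + ∫ s in (0 : ℝ)..t, V s (y s))‖ ≤ δ) :
    ∀ t ∈ Icc 0 T, ‖x t - y t‖ ≤ 2 * δ * Real.exp (2 * ∫ s in (0 : ℝ)..T, κ s) := by
  refine le_exp_of_le_integral_mul hV.integrableOn hV.nonneg hδ (hxc.sub hyc).norm fun t ht => ?_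
  have h0 : (0 : ℝ) ∈ Icc 0 T := ⟨le_rfl, ht.1.trans ht.2⟩
  have hxi := intervalIntegrable_of_integrableOn_Icc (hV.integrableOn_comp hxc) h0 ht
  have hyi := intervalIntegrable_of_integrableOn_Icc (hV.integrableOn_comp hyc) h0 ht
  have h1 : ‖∫ s in (0 : ℝ)..t, (V s (x s) - V s (y s))‖ ≤ ∫ s in (0 : ℝ)..t, κ s * ‖x s - y s‖ :=
    intervalIntegral.norm_integral_le_of_norm_le ht.1 (.of_forall fun s hs =>
      hV.lipschitz s ⟨hs.1.le, hs.2.trans ht.2⟩ _ _)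
      (intervalIntegrable_of_integrableOn_Icc (hV.integrableOn.mul_continuousOn
        (hxc.sub hyc).norm isCompact_Icc) h0 ht)
  have h2 : x t - y t = (∫ s in (0 : ℝ)..t, (V s (x s) - V s (y s))) -
      (y t - (x₀ + ∫ s in (0 : ℝ)..t, V s (y s))) := by
    rw [intervalIntegral.integral_sub hxi hyi]
    conv_lhs => rw [hx t ht]
    abel
  rw [h2]
  refine (norm_sub_le _ _).trans ?_
  have := hy t ht
  linarith

end IsCaratheodoryField

/-! ### The dual of `L^p` -/

section Dual

variable {α : Type*} {m : MeasurableSpace α} {μ : Measure α} [IsFiniteMeasure μ]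
  {p p' : ℝ≥0∞} [Fact (1 ≤ p)] [Fact (1 ≤ p')]

theorem hasSum_indicatorConstLp_iUnion (hp : p ≠ ∞) {f : ℕ → Set α} (hf : ∀ i, MeasurableSet (f i))
    (hd : Pairwise (Function.onFun Disjoint f)) :
    HasSum (fun i => indicatorConstLp p (hf i) (measure_ne_top μ _) (1 : ℝ))
      (indicatorConstLp p (MeasurableSet.iUnion hf) (measure_ne_top μ _) (1 : ℝ)) := by
  have hmeas : ∀ s : Finset ℕ, MeasurableSet (⋃ i ∈ s, f i) := fun s =>
    s.measurableSet_biUnion fun i _ => hf i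
  have hsum : ∀ s : Finset ℕ, ∑ i ∈ s, indicatorConstLp p (hf i) (measure_ne_top μ _) (1 : ℝ) =
      indicatorConstLp p (hmeas s) (measure_ne_top μ _) (1 : ℝ) := by
    intro s
    induction s using Finset.induction_on with
    | empty => simp
    | insert i s his ih =>
      rw [Finset.sum_insert his, ih, ← indicatorConstLp_disjoint_union]
      · simp
      · simp only [disjoint_iUnion_right]
        exact fun j hj => hd fun h => his (h ▸ hj)
  simp only [HasSum, SummationFilter.unconditional_filter, hsum]
  refine tendsto_indicatorConstLp_set hp ?_
  have hsd : ∀ s : Finset ℕ, symmDiff (⋃ i ∈ s, f i) (⋃ i, f i) = (⋃ i, f i) \ ⋃ i ∈ s, f i :=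
    fun s => symmDiff_of_le (iUnion₂_subset fun i _ => subset_iUnion f i)
  simp only [hsd]
  have := tendsto_measure_iInter_atTop (μ := μ) (s := fun s : Finset ℕ => (⋃ i, f i) \ ⋃ i ∈ s, f i)
    (fun s => ((MeasurableSet.iUnion hf).diff (hmeas s)).nullMeasurableSet)
    (fun s t hst => sdiff_subset_sdiff_right (biUnion_subset_biUnion_left hst))
    ⟨∅, measure_ne_top _ _⟩
  have hempty : ⋂ s : Finset ℕ, (⋃ i, f i) \ ⋃ i ∈ s, f i = ∅ := by
    refine eq_empty_of_forall_notMem fun x hx => ?_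
    rw [mem_iInter] at hx
    obtain ⟨i, hi⟩ := mem_iUnion.1 (hx ∅).1
    exact (hx {i}).2 (by simpa using hi)
  rwa [hempty, measure_empty] at this

/-- The signed measure `A ↦ ψ(1_A)` induced by a continuous linear functional `ψ` on `L^p`. -/
noncomputable def dualSignedMeasure (hp : p ≠ ∞) (ψ : StrongDual ℝ (Lp ℝ p μ)) :
    SignedMeasure α where
  measureOf' A := by
    classical
    exact if h : MeasurableSet A then ψ (indicatorConstLp p h (measure_ne_top μ A) 1) else 0
  empty' := by simp
  not_measurable' A hA := by simp [hA]
  m_iUnion' f hf hd := by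
    simp only [hf, MeasurableSet.iUnion hf, dif_pos]
    exact (hasSum_indicatorConstLp_iUnion hp hf hd).mapL ψ

theorem dualSignedMeasure_apply (hp : p ≠ ∞) (ψ : StrongDual ℝ (Lp ℝ p μ)) {A : Set α}
    (hA : MeasurableSet A) :
    dualSignedMeasure hp ψ A = ψ (indicatorConstLp p hA (measure_ne_top μ A) 1) := by
  simp [dualSignedMeasure, hA]

theorem exists_density_of_dual (hp : p ≠ ∞) (ψ : StrongDual ℝ (Lp ℝ p μ)) :
    ∃ g : α → ℝ, Measurable g ∧ Integrable g μ ∧ ∀ A (hA : MeasurableSet A),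
      ψ (indicatorConstLp p hA (measure_ne_top μ A) 1) = ∫ x in A, g x ∂μ := by
  refine ⟨(dualSignedMeasure hp ψ).rnDeriv μ, SignedMeasure.measurable_rnDeriv _ _,
    SignedMeasure.integrable_rnDeriv _ _, fun A hA => ?_⟩
  rw [← withDensityᵥ_apply (SignedMeasure.integrable_rnDeriv _ _) hA,
    SignedMeasure.withDensityᵥ_rnDeriv_eq, dualSignedMeasure_apply hp ψ hA]
  refine VectorMeasure.AbsolutelyContinuous.mk fun s hs h0 => ?_
  rw [Measure.toENNRealVectorMeasure_apply_measurable hs] at h0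
  rw [dualSignedMeasure_apply hp ψ hs]
  have : indicatorConstLp p hs (measure_ne_top μ s) (1 : ℝ) = 0 := by
    have h1 := norm_indicatorConstLp_le (p := p) (hs := hs) (hμs := measure_ne_top μ s)
      (c := (1 : ℝ))
    have hpp : p.toReal ≠ 0 :=
      (ENNReal.toReal_pos (zero_lt_one.trans_le Fact.out).ne' hp).ne'
    rw [Measure.real, h0, ENNReal.toReal_zero, Real.zero_rpow (by simpa using hpp), mul_zero] at h1
    exact norm_le_zero_iff.1 h1
  rw [this, map_zero]

theorem dual_ext_indicator (hp : p ≠ ∞) {φ ψ : StrongDual ℝ (Lp ℝ p μ)}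
    (h : ∀ A (hA : MeasurableSet A), φ (indicatorConstLp p hA (measure_ne_top μ A) 1) =
      ψ (indicatorConstLp p hA (measure_ne_top μ A) 1)) : φ = ψ := by
  ext u
  induction u using Lp.induction hp with
  | indicatorConst c hs hμs =>
    have : ((Lp.simpleFunc.indicatorConst p hs hμs.ne c : Lp.simpleFunc ℝ p μ) : Lp ℝ p μ) =
        c • indicatorConstLp p hs (measure_ne_top μ _) (1 : ℝ) := by
      rw [Lp.simpleFunc.coe_indicatorConst]
      refine Lp.ext ?_
      filter_upwards [indicatorConstLp_coeFn (p := p) (hs := hs) (hμs := hμs.ne) (c := c),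
        Lp.coeFn_smul c (indicatorConstLp p hs (measure_ne_top μ _) (1 : ℝ)),
        indicatorConstLp_coeFn (p := p) (hs := hs) (hμs := measure_ne_top μ _) (c := (1 : ℝ))]
        with x h1 h2 h3
      rw [h1, h2, Pi.smul_apply, h3, ← indicator_const_smul_apply, smul_eq_mul, mul_one]
    rw [this, map_smul, map_smul, h]
  | add hf hg _ h1 h2 => rw [map_add, map_add, h1, h2]
  | isClosed => exact isClosed_eq φ.continuous ψ.continuous

variable [p.HolderConjugate p']

/-- A bounded function `g` such that `∫ g u ≤ C ‖u‖` for all `u ∈ L^p` that vanish where `g` does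
has `L^{p'}` norm at most `C`: test with the function `sign(g) |g|^{p'-1}`, the equality case of
Hölder's inequality. -/
theorem eLpNorm_le_of_forall_integral_eq (hp : p ≠ ∞) (hp' : p' ≠ ∞) {g : α → ℝ}
    (hg : Measurable g) {N : ℝ} (hgN : ∀ x, |g x| ≤ N) {C : ℝ} (hC : 0 ≤ C)
    (h : ∀ u : α → ℝ, ∀ hu : MemLp u p μ, (∀ x, g x = 0 → u x = 0) →
      ∫ x, g x * u x ∂μ ≤ C * ‖hu.toLp u‖) :
    eLpNorm g p' μ ≤ ENNReal.ofReal C := by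
  have hconj : p.toReal.HolderConjugate p'.toReal := ENNReal.HolderConjugate.toReal_of_ne_top hp hp'
  set r := p.toReal
  set s := p'.toReal
  have hr1 : 1 < r := hconj.lt
  have hs1 : 1 < s := hconj.symm.lt
  have hp0 : p ≠ 0 := (zero_lt_one.trans_le Fact.out).ne'
  have hp'0 : p' ≠ 0 := (zero_lt_one.trans_le Fact.out).ne'
  have hg' : MemLp g p' μ := MemLp.of_bound hg.aestronglyMeasurable N (.of_forall hgN)
  set u : α → ℝ := fun x => SignType.sign (g x) * |g x| ^ (s - 1) with hu_def
  have habs : ∀ x, |u x| = |g x| ^ (s - 1) := fun x => by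
    rcases eq_or_ne (g x) 0 with h0 | h0
    · simp [hu_def, h0, Real.zero_rpow (by linarith : s - 1 ≠ 0)]
    · rw [hu_def]
      simp only [abs_mul, abs_of_nonneg (Real.rpow_nonneg (abs_nonneg (g x)) _)]
      rcases lt_or_gt_of_ne h0 with h1 | h1 <;> simp [h1]
  have hgu : ∀ x, g x * u x = |g x| ^ s := fun x => by
    rw [hu_def]
    simp only
    rw [← mul_assoc, mul_comm (g x), sign_mul_self]
    rcases eq_or_ne (g x) 0 with h0 | h0
    · simp [h0, Real.zero_rpow (by linarith : s ≠ 0)]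
    · rw [← Real.rpow_one_add' (abs_nonneg _) (by linarith)]
      congr 1; ring
  have humeas : Measurable u := by
    have h1 : u = fun x => g x * |g x| ^ (s - 2) := by
      ext x
      rcases eq_or_ne (g x) 0 with h0 | h0
      · simp [hu_def, h0]
      · rw [hu_def]
        simp only
        rw [show s - 1 = 1 + (s - 2) by ring, Real.rpow_add (abs_pos.2 h0), Real.rpow_one,
          ← mul_assoc, sign_mul_abs]
    rw [h1]
    exact hg.mul (hg.abs.pow_const _)
  have hu : MemLp u p μ := by
    refine MemLp.of_bound humeas.aestronglyMeasurable (N ^ (s - 1)) (.of_forall fun x => ?_)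
    rw [Real.norm_eq_abs, habs]
    exact Real.rpow_le_rpow (abs_nonneg _) (hgN x) (by linarith)
  have key := h u hu fun x hx => by simp [hu_def, hx]
  simp only [hgu] at key
  set I := ∫ x, |g x| ^ s ∂μ with hI
  have hI0 : 0 ≤ I := integral_nonneg fun x => by positivity
  have hun : ‖hu.toLp u‖ = I ^ r⁻¹ := by
    rw [Lp.norm_toLp, hu.eLpNorm_eq_integral_rpow_norm hp0 hp,
      ENNReal.toReal_ofReal (by positivity)]
    have : ∫ x, ‖u x‖ ^ p.toReal ∂μ = I := by
      refine integral_congr_ae (.of_forall fun x => ?_)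
      simp only
      rw [Real.norm_eq_abs, habs, ← Real.rpow_mul (abs_nonneg _)]
      congr 1
      exact hconj.symm.sub_one_mul_conj
    rw [this]
  rw [hun] at key
  rw [hg'.eLpNorm_eq_integral_rpow_norm hp'0 hp']
  refine ENNReal.ofReal_le_ofReal ?_
  change I ^ s⁻¹ ≤ C
  rcases hI0.eq_or_lt with h0 | h0
  · rw [← h0, Real.zero_rpow (by positivity)]; exact hC
  · have h1 : I = I ^ s⁻¹ * I ^ r⁻¹ := by
      rw [← Real.rpow_add h0, add_comm, hconj.inv_add_inv_eq_one, Real.rpow_one]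
    have h2 : 0 < I ^ r⁻¹ := by positivity
    rw [h1] at key
    refine le_of_mul_le_mul_right (le_trans (le_of_eq ?_) (le_trans key (le_of_eq ?_))) h2
    · rfl
    · rw [← h1]

/-- **Riesz representation** for `L^p(μ)` with `1 < p < ∞` and `μ` finite, scalar case: the density
`g` of the signed measure `A ↦ ψ(1_A)` belongs to `L^{p'}`, as its truncations have `L^{p'}` norm at
most `‖ψ‖`. -/
theorem exists_lpPairing_eq_real (hp : p ≠ ∞) (hp' : p' ≠ ∞) (ψ : StrongDual ℝ (Lp ℝ p μ)) :
    ∃ g : Lp ℝ p' μ, ∀ u : Lp ℝ p μ, ψ u = ∫ x, g x * u x ∂μ := by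
  obtain ⟨g, hg, hgi, hψ⟩ := exists_density_of_dual hp ψ
  have : p'.HolderConjugate p := ENNReal.HolderConjugate.symm (p := p) (q := p')
  set A : ℕ → Set α := fun N => {x | |g x| ≤ N} with hA_def
  have hA : ∀ N, MeasurableSet (A N) := fun N => measurableSet_le hg.abs measurable_const
  set gN : ℕ → α → ℝ := fun N => (A N).indicator g with hgN_def
  have hgNm : ∀ N, Measurable (gN N) := fun N => hg.indicator (hA N)
  have hgNb : ∀ N x, |gN N x| ≤ N := fun N x => by
    by_cases hx : x ∈ A N
    · change |(A N).indicator g x| ≤ N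
      rw [indicator_of_mem hx]
      exact hx
    · simp [hgN_def, hx]
  have hgNL : ∀ N, MemLp (gN N) p' μ := fun N =>
    MemLp.of_bound (hgNm N).aestronglyMeasurable N (.of_forall (hgNb N))
  -- multiplication by the indicator function of `A N`
  set mulA : ℕ → Lp ℝ p μ →L[ℝ] Lp ℝ p μ := fun N =>
    (ContinuousLinearMap.mul ℝ ℝ).holderL μ ∞ p p
      (indicatorConstLp ∞ (hA N) (measure_ne_top μ _) 1) with hmulA
  have hmulA_coe : ∀ N (u : Lp ℝ p μ), mulA N u =ᵐ[μ] (A N).indicator u := fun N u => by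
    have h1 := (ContinuousLinearMap.mul ℝ ℝ).coeFn_holder (r := p)
      (indicatorConstLp ∞ (hA N) (measure_ne_top μ _) 1) u
    filter_upwards [h1, indicatorConstLp_coeFn (p := ∞) (hs := hA N) (hμs := measure_ne_top μ (A N))
      (c := (1 : ℝ))] with x hx hx'
    simp only [hmulA, ContinuousLinearMap.holderL_apply_apply]
    rw [hx, hx']
    by_cases h : x ∈ A N <;> simp [h]
  have hrep : ∀ N, ψ.comp (mulA N) =
      (ContinuousLinearMap.mul ℝ ℝ).lpPairing μ p' p ((hgNL N).toLp (gN N)) := by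
    intro N
    refine dual_ext_indicator hp fun B hB => ?_
    have h1 : mulA N (indicatorConstLp p hB (measure_ne_top μ B) 1) =
        indicatorConstLp p ((hA N).inter hB) (measure_ne_top μ _) 1 := by
      refine Lp.ext ((hmulA_coe N _).trans ?_)
      filter_upwards [indicatorConstLp_coeFn (p := p) (hs := hB) (hμs := measure_ne_top μ B)
        (c := (1 : ℝ)), indicatorConstLp_coeFn (p := p) (hs := (hA N).inter hB)
        (hμs := measure_ne_top μ _) (c := (1 : ℝ))] with x h1 h2
      rw [h2, ← indicator_indicator]
      by_cases h : x ∈ A N <;> simp [h, h1]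
    rw [ContinuousLinearMap.comp_apply, h1, hψ, ContinuousLinearMap.lpPairing_eq_integral,
      ← integral_indicator ((hA N).inter hB)]
    refine integral_congr_ae ?_
    filter_upwards [(hgNL N).coeFn_toLp, indicatorConstLp_coeFn (p := p) (hs := hB)
      (hμs := measure_ne_top μ B) (c := (1 : ℝ))] with x h2 h3
    rw [h2, h3]
    by_cases h : x ∈ A N <;> by_cases h' : x ∈ B <;> simp [hgN_def, h, h']
  have hbound : ∀ N, eLpNorm (gN N) p' μ ≤ ENNReal.ofReal ‖ψ‖ := by
    intro N
    refine eLpNorm_le_of_forall_integral_eq (p := p) hp hp' (hgNm N) (hgNb N) (norm_nonneg ψ)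
      fun u hu hu0 => ?_
    have h1 := congrArg (fun φ : StrongDual ℝ (Lp ℝ p μ) => φ (hu.toLp u)) (hrep N)
    simp only [ContinuousLinearMap.comp_apply, ContinuousLinearMap.lpPairing_eq_integral] at h1
    have h2 : ∫ x, gN N x * u x ∂μ = ψ (mulA N (hu.toLp u)) := by
      rw [h1]
      refine integral_congr_ae ?_
      filter_upwards [(hgNL N).coeFn_toLp, hu.coeFn_toLp] with x h2 h3
      rw [h2, h3]; rfl
    have h3 : ‖mulA N (hu.toLp u)‖ ≤ ‖hu.toLp u‖ := by
      refine Lp.norm_le_norm_of_ae_le ?_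
      filter_upwards [hmulA_coe N (hu.toLp u)] with x hx
      rw [hx]
      exact norm_indicator_le_norm_self _ _
    rw [h2]
    exact (le_abs_self _).trans ((ψ.le_opNorm _).trans
      (mul_le_mul_of_nonneg_left h3 (norm_nonneg _)))
  have hgL : MemLp g p' μ := by
    refine ⟨hg.aestronglyMeasurable, lt_of_le_of_lt (Lp.eLpNorm_lim_le_liminf_eLpNorm
      (fun N => (hgNm N).aestronglyMeasurable) g (.of_forall fun x => ?_))
      (lt_of_le_of_lt (Filter.liminf_le_of_le (a := ENNReal.ofReal ‖ψ‖) (by isBoundedDefault)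
        fun b hb => ?_)
        (ENNReal.ofReal_lt_top (r := ‖ψ‖)))⟩
    · refine tendsto_const_nhds.congr' ?_
      obtain ⟨N, hN⟩ := exists_nat_ge |g x|
      filter_upwards [Filter.eventually_ge_atTop N] with M hM
      have : x ∈ A M := hN.trans (by exact_mod_cast hM)
      simp [hgN_def, this]
    · obtain ⟨N, hN⟩ := hb.exists
      exact hN.trans (hbound N)
  refine ⟨hgL.toLp g, fun u => ?_⟩
  have : ψ = (ContinuousLinearMap.mul ℝ ℝ).lpPairing μ p' p (hgL.toLp g) := by
    refine dual_ext_indicator hp fun B hB => ?_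
    rw [hψ, ContinuousLinearMap.lpPairing_eq_integral, ← integral_indicator hB]
    refine integral_congr_ae ?_
    filter_upwards [hgL.coeFn_toLp, indicatorConstLp_coeFn (p := p) (hs := hB)
      (hμs := measure_ne_top μ B) (c := (1 : ℝ))] with x h2 h3
    rw [h2, h3]
    by_cases h' : x ∈ B <;> simp [h']
  conv_lhs => rw [this]
  rw [ContinuousLinearMap.lpPairing_eq_integral]
  rfl

/-- **Riesz representation** for `L^p(μ; ℝ^k)`, `1 < p < ∞`, obtained coordinatewise. -/
theorem exists_lpPairing_eq {k : ℕ} (hp : p ≠ ∞) (hp' : p' ≠ ∞) [p'.HolderConjugate p]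
    (φ : StrongDual ℝ (Lp (EuclideanSpace ℝ (Fin k)) p μ)) :
    ∃ g : Lp (EuclideanSpace ℝ (Fin k)) p' μ, φ = (innerSL ℝ).lpPairing μ p' p g := by
  set S : Fin k → ℝ →L[ℝ] EuclideanSpace ℝ (Fin k) := fun i =>
    ContinuousLinearMap.toSpanSingleton ℝ (EuclideanSpace.single i 1) with hS
  set P : Fin k → EuclideanSpace ℝ (Fin k) →L[ℝ] ℝ := fun i => EuclideanSpace.proj i with hP
  choose g hg using fun i => exists_lpPairing_eq_real (p' := p') hp hp'
    (φ.comp ((S i).compLpL p μ))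
  refine ⟨∑ i, (S i).compLpL p' μ (g i), ?_⟩
  ext u
  have hu : u = ∑ i, (S i).compLpL p μ ((P i).compLpL p μ u) := by
    refine Lp.ext ?_
    have h1 : ∀ i, (S i).compLpL p μ ((P i).compLpL p μ u) =ᵐ[μ] fun x => S i (P i (u x)) :=
      fun i => by
        filter_upwards [(S i).coeFn_compLpL (p := p) ((P i).compLpL p μ u),
          (P i).coeFn_compLpL (p := p) u] with x h1 h2
        rw [h1, h2]
    filter_upwards [Lp.coeFn_fun_finsetSum Finset.univ
      (fun i => (S i).compLpL p μ ((P i).compLpL p μ u)), ae_all_iff.2 h1] with x h2 h3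
    rw [h2]
    simp only [h3]
    ext j
    simp [hS, hP, Finset.sum_apply, Pi.single_apply]
  conv_lhs => rw [hu]
  rw [map_sum, map_sum, _root_.sum_apply]
  refine Finset.sum_congr rfl fun i _ => ?_
  have h1 := hg i ((P i).compLpL p μ u)
  rw [ContinuousLinearMap.comp_apply] at h1
  rw [h1, ContinuousLinearMap.lpPairing_eq_integral]
  refine integral_congr_ae ?_
  filter_upwards [(S i).coeFn_compLpL (p := p') (g i), (P i).coeFn_compLpL (p := p) u] with x h1 h2
  rw [h1, h2]
  rw [innerSL_apply_apply]
  simp [hS, hP, real_inner_smul_left, EuclideanSpace.inner_single_left]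

/-- Bounded sequences in `L^p(μ; ℝ^k)`, `1 < p < ∞`, have weakly convergent subsequences. -/
theorem exists_subseq_tendsto_dual {k : ℕ} [IsSeparable μ] (hp : 1 < p) (hp_top : p ≠ ∞)
    {u : ℕ → Lp (EuclideanSpace ℝ (Fin k)) p μ} {r : ℝ} (hu : ∀ j, ‖u j‖ ≤ r) :
    ∃ (v : Lp (EuclideanSpace ℝ (Fin k)) p μ) (σ : ℕ → ℕ), StrictMono σ ∧
      ∀ φ : StrongDual ℝ (Lp (EuclideanSpace ℝ (Fin k)) p μ),
        Filter.Tendsto (fun j => φ (u (σ j))) Filter.atTop (nhds (φ v)) := by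
  set p' := p.conjExponent with hp'_def
  have hp'1 : 1 < p' := by
    rw [hp'_def, ENNReal.conjExponent]
    refine ENNReal.lt_add_right ENNReal.one_ne_top ?_
    rw [Ne, ENNReal.inv_eq_zero]
    exact fun h => hp_top (by simpa using h)
  have hp'_top : p' ≠ ∞ := by
    rw [hp'_def, ENNReal.conjExponent]
    refine ENNReal.add_ne_top.2 ⟨ENNReal.one_ne_top, ?_⟩
    rw [Ne, ENNReal.inv_eq_top, tsub_eq_zero_iff_le, not_le]
    exact hp
  have : Fact (1 ≤ p') := ⟨hp'1.le⟩
  have : Fact (p' ≠ ∞) := ⟨hp'_top⟩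
  have hpp' : p.HolderConjugate p' := ENNReal.HolderConjugate.conjExponent hp.le
  have hp'p : p'.HolderConjugate p := ENNReal.HolderConjugate.symm (p := p) (q := p')
  set B : EuclideanSpace ℝ (Fin k) →L[ℝ] EuclideanSpace ℝ (Fin k) →L[ℝ] ℝ := innerSL ℝ with hB
  set J := B.lpPairing μ p p' with hJ
  have hsymm : ∀ (g : Lp (EuclideanSpace ℝ (Fin k)) p' μ) (w : Lp (EuclideanSpace ℝ (Fin k)) p μ),
      B.lpPairing μ p' p g w = J w g := fun g w => by
    rw [hJ, ContinuousLinearMap.lpPairing_eq_integral, ContinuousLinearMap.lpPairing_eq_integral]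
    refine integral_congr_ae (.of_forall fun x => ?_)
    change inner ℝ (g x) (w x) = inner ℝ (w x) (g x)
    exact real_inner_comm _ _
  obtain ⟨Φ, -, σ, hσ, hΦ⟩ := WeakDual.isSeqCompact_closedBall ℝ
    (Lp (EuclideanSpace ℝ (Fin k)) p' μ) 0 (‖J‖ * r)
    (x := fun j => StrongDual.toWeakDual (J (u j))) (fun j => by
      simp only [mem_preimage, StrongDual.toStrongDual_toWeakDual, mem_closedBall_zero_iff]
      exact (J.le_opNorm _).trans (mul_le_mul_of_nonneg_left (hu j) (norm_nonneg _)))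
  obtain ⟨v, hv⟩ := exists_lpPairing_eq hp'_top hp_top (WeakDual.toStrongDual Φ)
  refine ⟨v, σ, hσ, fun φ => ?_⟩
  obtain ⟨g, rfl⟩ := exists_lpPairing_eq hp_top hp'_top φ
  have h1 := (WeakDual.eval_continuous g).continuousAt.tendsto.comp hΦ
  have h2 : Φ g = B.lpPairing μ p' p g v := by
    rw [hsymm, hJ, ← hv]; rfl
  rw [h2] at h1
  refine h1.congr fun j => ?_
  rw [hsymm]; rfl

end Dual

theorem tendsto_toWeakSpace_iff {X : Type*} [NormedAddCommGroup X] [NormedSpace ℝ X]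
    {u : ℕ → X} {v : X} :
    Filter.Tendsto (fun j => toWeakSpace ℝ X (u j)) Filter.atTop (nhds (toWeakSpace ℝ X v)) ↔
      ∀ φ : StrongDual ℝ X, Filter.Tendsto (fun j => φ (u j)) Filter.atTop (nhds (φ v)) := by
  refine (WeakBilin.tendsto_iff_forall_eval_tendsto (B := (topDualPairing ℝ X).flip)
    (f := fun j => toWeakSpace ℝ X (u j)) (x := toWeakSpace ℝ X v) fun x y hxy => ?_)
  by_contra hne
  obtain ⟨φ, hφ⟩ := SeparatingDual.exists_separating_of_ne (R := ℝ) hne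
  exact hφ (DFunLike.congr_fun hxy φ)

/-! ### Carathéodory functions -/

/-- A function that is almost everywhere measurable in `ω` and, for almost every `ω`, continuous in
`i` agrees, outside a null set of `ω`, with a jointly measurable function. -/
theorem exists_measurable_uncurry_of_continuous {ι Ω : Type*} [TopologicalSpace ι]
    [TopologicalSpace.MetrizableSpace ι] [SecondCountableTopology ι] [MeasurableSpace ι]
    [OpensMeasurableSpace ι] [MeasurableSpace Ω] {μ : Measure Ω} {b : ι → Ω → ℝ}
    (hb : ∀ i, AEStronglyMeasurable (b i) μ) (hc : ∀ᵐ ω ∂μ, Continuous fun i => b i ω) :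
    ∃ b' : ι → Ω → ℝ, Measurable (Function.uncurry b') ∧ ∀ᵐ ω ∂μ, ∀ i, b i ω = b' i ω := by
  rcases isEmpty_or_nonempty ι with hι | hι
  · exact ⟨b, measurable_of_empty _, .of_forall fun ω i => (hι.false i).elim⟩
  have hD : ∀ᵐ ω ∂μ, ∀ n, b (TopologicalSpace.denseSeq ι n) ω = (hb _).mk _ ω :=
    ae_all_iff.2 fun n => (hb _).ae_eq_mk
  obtain ⟨G, hGae, hG, hGprop⟩ := (hc.and hD).exists_measurable_mem
  refine ⟨fun i => G.indicator (b i), measurable_uncurry_of_continuous_of_measurable ?_ ?_, ?_⟩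
  · intro ω
    by_cases h : ω ∈ G
    · simpa only [indicator_of_mem h] using (hGprop ω h).1
    · simpa only [indicator_of_notMem h] using continuous_const
  · intro i
    obtain ⟨x, hx, hxi⟩ := mem_closure_iff_seq_limit.1 (TopologicalSpace.denseRange_denseSeq ι i)
    refine measurable_of_tendsto_metrizable (f := fun j => G.indicator (b (x j))) (fun j => ?_) ?_
    · obtain ⟨n, hn⟩ := hx j
      have : G.indicator (b (x j)) = G.indicator ((hb (TopologicalSpace.denseSeq ι n)).mk _) := by
        rw [← hn]
        exact indicator_congr fun ω hω => (hGprop ω hω).2 n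
      rw [this]
      exact ((hb _).stronglyMeasurable_mk.measurable).indicator hG
    · rw [tendsto_pi_nhds]
      intro ω
      by_cases h : ω ∈ G
      · simpa only [indicator_of_mem h, Function.comp_def] using
          ((hGprop ω h).1.tendsto i).comp hxi
      · simpa only [indicator_of_notMem h] using tendsto_const_nhds
  · filter_upwards [hGae] with ω hω i
    simp [hω]

/-! ### The control cost -/

theorem lp_norm_rpow_eq_integral {α E : Type*} {m : MeasurableSpace α} {μ : Measure α}
    [NormedAddCommGroup E] {p : ℝ≥0∞} (hp0 : p ≠ 0) (hp : p ≠ ∞) (u : Lp E p μ) :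
    ‖u‖ ^ p.toReal = ∫ x, ‖u x‖ ^ p.toReal ∂μ := by
  have hI : 0 ≤ ∫ x, ‖u x‖ ^ p.toReal ∂μ := integral_nonneg fun x => by positivity
  rw [Lp.norm_def, (Lp.memLp u).eLpNorm_eq_integral_rpow_norm hp0 hp,
    ENNReal.toReal_ofReal (by positivity), Real.rpow_inv_rpow hI (ENNReal.toReal_pos hp0 hp).ne']

section ControlCost

variable {k : ℕ} {T : ℝ} {q : ℝ≥0∞} {f : ℝ → EuclideanSpace ℝ (Fin k) → ℝ}

theorem lp_integrable_norm_rpow (hq0 : q ≠ 0) (hq : q ≠ ∞) (u : ControlSpace T k q) :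
    IntegrableOn (fun t => ‖u t‖ ^ q.toReal) (Icc 0 T) :=
  (Lp.memLp u).integrable_norm_rpow hq0 hq

theorem IsControlCost.integrableOn (hf : IsControlCost T q f) (hq0 : q ≠ 0) (hq : q ≠ ∞)
    (u : ControlSpace T k q) : IntegrableOn (fun t => f t (u t)) (Icc 0 T) := by
  obtain ⟨f', hf'm, hf'⟩ := exists_measurable_uncurry_of_continuous (b := fun v t => f t v)
    hf.measurable (hf.continuous_convex.mono fun t ht => ht.1)
  obtain ⟨C₁, g, hC₁, hg, hg0, h1⟩ := hf.coercive
  obtain ⟨C₂, h, hC₂, hh, hh0, h2⟩ := hf.growth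
  refine Integrable.mono' ((hg.add hh).add ((lp_integrable_norm_rpow hq0 hq u).const_mul C₂)) ?_ ?_
  · have : AEStronglyMeasurable (fun t => f' (u t) t) (volume.restrict (Icc 0 T)) :=
      (hf'm.comp_aemeasurable
        ((Lp.stronglyMeasurable u).measurable.aemeasurable.prodMk
          aemeasurable_id)).aestronglyMeasurable
    refine this.congr ?_
    filter_upwards [hf'] with t ht
    rw [ht]
  · filter_upwards [h1, h2] with t h1 h2
    have h1 := h1 (u t)
    have h2 := h2 (u t)
    have h3 := hg0 t
    have h4 := hh0 t
    have h5 : 0 ≤ ‖u t‖ ^ q.toReal := by positivity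
    rw [Real.norm_eq_abs, abs_le]
    simp only [Pi.add_apply]
    constructor <;> nlinarith

theorem IsControlCost.exists_coercive (hf : IsControlCost T q f) (hq0 : q ≠ 0) (hq : q ≠ ∞) :
    ∃ C c : ℝ, 0 < C ∧ ∀ u : ControlSpace T k q, C * ‖u‖ ^ q.toReal - c ≤ controlCost T f u := by
  obtain ⟨C, g, hC, hg, hg0, h1⟩ := hf.coercive
  refine ⟨C, ∫ t in Icc 0 T, g t, hC, fun u => ?_⟩
  have hu := (lp_integrable_norm_rpow hq0 hq u).const_mul C
  rw [lp_norm_rpow_eq_integral hq0 hq, ← integral_const_mul, ← integral_sub hu hg]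
  refine integral_mono_ae (hu.sub hg) (hf.integrableOn hq0 hq u) ?_
  filter_upwards [h1] with t ht using ht (u t)

theorem IsControlCost.convexOn [Fact (1 ≤ q)] (hf : IsControlCost T q f) (hq0 : q ≠ 0)
    (hq : q ≠ ∞) : ConvexOn ℝ univ (fun u : ControlSpace T k q => controlCost T f u) := by
  refine ⟨convex_univ, fun u _ v _ a b ha hb hab => ?_⟩
  simp only [controlCost, smul_eq_mul]
  rw [← integral_const_mul, ← integral_const_mul, ← integral_add
    ((hf.integrableOn hq0 hq u).const_mul a) ((hf.integrableOn hq0 hq v).const_mul b)]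
  refine integral_mono_ae (hf.integrableOn hq0 hq _) (((hf.integrableOn hq0 hq u).const_mul a).add
    ((hf.integrableOn hq0 hq v).const_mul b)) ?_
  filter_upwards [hf.continuous_convex, Lp.coeFn_add (a • u) (b • v), Lp.coeFn_smul a u,
    Lp.coeFn_smul b v] with t ht h1 h2 h3
  rw [h1, Pi.add_apply, h2, h3]
  exact ht.2.2 (mem_univ _) (mem_univ _) ha hb hab

/-- Sublevel sets of the control cost are closed in `L^q`, by Fatou's lemma. -/
theorem IsControlCost.isClosed_sublevel [Fact (1 ≤ q)] (hf : IsControlCost T q f) (hq0 : q ≠ 0)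
    (hq : q ≠ ∞) (B : ℝ) : IsClosed {u : ControlSpace T k q | controlCost T f u ≤ B} := by
  refine IsSeqClosed.isClosed fun u v hu huv => ?_
  obtain ⟨C, g, hC, hg, hg0, h1⟩ := hf.coercive
  obtain ⟨σ, -, hσ⟩ := (tendstoInMeasure_of_tendsto_Lp huv).exists_seq_tendsto_ae
  have hnn : ∀ w : ControlSpace T k q,
      0 ≤ᵐ[volume.restrict (Icc 0 T)] fun t => f t (w t) + g t := fun w => by
    filter_upwards [h1] with t ht
    have := ht (w t)
    have h2 : 0 ≤ C * ‖w t‖ ^ q.toReal := by positivity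
    change (0 : ℝ) ≤ f t (w t) + g t
    linarith
  have hint : ∀ w : ControlSpace T k q, IntegrableOn (fun t => f t (w t) + g t) (Icc 0 T) :=
    fun w => (hf.integrableOn hq0 hq w).add hg
  have heq : ∀ w : ControlSpace T k q, ∫⁻ t in Icc 0 T, ENNReal.ofReal (f t (w t) + g t) =
      ENNReal.ofReal (controlCost T f w + ∫ t in Icc 0 T, g t) := fun w => by
    rw [← ofReal_integral_eq_lintegral_ofReal (hint w) (hnn w),
      integral_add (hf.integrableOn hq0 hq w) hg]
    rfl
  have hle : ∫⁻ t in Icc 0 T, ENNReal.ofReal (f t (v t) + g t) ≤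
      ENNReal.ofReal (B + ∫ t in Icc 0 T, g t) := by
    calc ∫⁻ t in Icc 0 T, ENNReal.ofReal (f t (v t) + g t)
        = ∫⁻ t in Icc 0 T, Filter.liminf
            (fun j => ENNReal.ofReal (f t (u (σ j) t) + g t)) Filter.atTop := by
          refine lintegral_congr_ae ?_
          filter_upwards [hσ, hf.continuous_convex] with t ht hc
          refine (Filter.Tendsto.liminf_eq ?_).symm
          exact (ENNReal.continuous_ofReal.tendsto _).comp
            (((hc.1.tendsto _).comp ht).add_const _)
      _ ≤ Filter.liminf (fun j => ∫⁻ t in Icc 0 T, ENNReal.ofReal (f t (u (σ j) t) + g t))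
            Filter.atTop := lintegral_liminf_le' fun j =>
              (hint (u (σ j))).aestronglyMeasurable.aemeasurable.ennreal_ofReal
      _ ≤ ENNReal.ofReal (B + ∫ t in Icc 0 T, g t) := by
          refine Filter.liminf_le_of_le (by isBoundedDefault) fun b hb => ?_
          obtain ⟨j, hj⟩ := hb.exists
          refine hj.trans ?_
          rw [heq]
          have h2 : controlCost T f (u (σ j)) ≤ B := hu (σ j)
          exact ENNReal.ofReal_le_ofReal (by linarith)
  rw [heq] at hle
  have h0 : 0 ≤ B + ∫ t in Icc 0 T, g t := by
    have h2 : controlCost T f (u 0) ≤ B := hu 0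
    have h3 : 0 ≤ ∫ t in Icc 0 T, (f t (u 0 t) + g t) := integral_nonneg_of_ae (hnn (u 0))
    rw [integral_add (hf.integrableOn hq0 hq _) hg] at h3
    change 0 ≤ controlCost T f (u 0) + _ at h3
    linarith
  have := (ENNReal.ofReal_le_ofReal_iff h0).1 hle
  change controlCost T f v ≤ B
  linarith

/-- Weak sequential lower semicontinuity of the control cost: its sublevel sets are convex and
closed, hence weakly closed. -/
theorem IsControlCost.eventually_lt_of_tendsto [Fact (1 ≤ q)] (hf : IsControlCost T q f)
    (hq0 : q ≠ 0) (hq : q ≠ ∞) {u : ℕ → ControlSpace T k q} {v : ControlSpace T k q}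
    (huv : Filter.Tendsto (fun j => toWeakSpace ℝ (ControlSpace T k q) (u j)) Filter.atTop
      (nhds (toWeakSpace ℝ (ControlSpace T k q) v))) {B : ℝ} (hB : B < controlCost T f v) :
    ∀ᶠ j in Filter.atTop, B < controlCost T f (u j) := by
  by_contra hcon
  rw [Filter.not_eventually] at hcon
  set S := {u : ControlSpace T k q | controlCost T f u ≤ B} with hS
  have hconv : Convex ℝ S := by simpa [hS] using (hf.convexOn hq0 hq).convex_le B
  have hclosed : IsClosed (toWeakSpace ℝ (ControlSpace T k q) '' S) := by
    rw [← closure_eq_iff_isClosed, ← hconv.toWeakSpace_closure ℝ,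
      (hf.isClosed_sublevel hq0 hq B).closure_eq]
  have := hclosed.mem_of_frequently_of_tendsto
    (hcon.mono fun j hj => mem_image_of_mem _ (not_lt.1 hj)) huv
  obtain ⟨w, hw, hwv⟩ := this
  rw [(toWeakSpace ℝ (ControlSpace T k q)).injective hwv] at hw
  exact absurd hB (not_lt.2 hw)

end ControlCost

/-! ### Trajectories of the controlled system -/

/-- Hölder's inequality on a subinterval. -/
theorem integral_norm_le_of_lp {k : ℕ} {T : ℝ} {q : ℝ≥0∞} (hq : 1 ≤ q)
    (u : ControlSpace T k q) {s t : ℝ} (hs : 0 ≤ s) (hst : s ≤ t) (ht : t ≤ T) :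
    ∫ r in s..t, ‖u r‖ ≤ (t - s) ^ (1 - 1 / q.toReal) * ‖u‖ := by
  have hsub : Ioc s t ⊆ Icc 0 T := fun r hr => ⟨hs.trans hr.1.le, hr.2.trans ht⟩
  have hmono : (volume.restrict (Ioc s t)) ≤ volume.restrict (Icc (0 : ℝ) T) :=
    Measure.restrict_mono_set _ hsub
  have hu : MemLp u q (volume.restrict (Ioc s t)) := (Lp.memLp u).mono_measure hmono
  have hexp : 0 ≤ 1 - 1 / q.toReal := by
    rcases eq_or_ne q ∞ with h | h
    · simp [h]
    · have h1 : 1 ≤ q.toReal := by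
        simpa using (ENNReal.toReal_le_toReal ENNReal.one_ne_top h).2 hq
      rw [sub_nonneg]
      exact div_le_one_of_le₀ h1 (by linarith)
  rw [intervalIntegral.integral_of_le hst, integral_norm_eq_lintegral_enorm hu.1,
    ← eLpNorm_one_eq_lintegral_enorm]
  have h1 := eLpNorm_le_eLpNorm_mul_rpow_measure_univ hq hu.1
  have h2 : eLpNorm u q (volume.restrict (Ioc s t)) ≤ eLpNorm u q (volume.restrict (Icc 0 T)) :=
    eLpNorm_mono_measure _ hmono
  have h3 : (volume.restrict (Ioc s t)) univ = ENNReal.ofReal (t - s) := by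
    simp
  rw [h3, ENNReal.toReal_one, div_one] at h1
  have h4 := h1.trans (mul_le_mul_left h2 _)
  have h5 : eLpNorm u q (volume.restrict (Icc 0 T)) *
      ENNReal.ofReal (t - s) ^ (1 - 1 / q.toReal) ≠ ∞ :=
    ENNReal.mul_ne_top (Lp.eLpNorm_ne_top u)
      (ENNReal.rpow_ne_top_of_nonneg hexp ENNReal.ofReal_ne_top)
  refine (ENNReal.toReal_mono h5 h4).trans_eq ?_
  rw [ENNReal.toReal_mul, ← ENNReal.toReal_rpow, ENNReal.toReal_ofReal (by linarith), mul_comm,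
    Lp.norm_def]

theorem lp_integrableOn {k : ℕ} {T : ℝ} {q : ℝ≥0∞} (hq : 1 ≤ q) (u : ControlSpace T k q) :
    IntegrableOn u (Icc 0 T) := (Lp.memLp u).integrable hq

theorem norm_sum_smul_le {E : Type*} [NormedAddCommGroup E] [NormedSpace ℝ E] {k : ℕ}
    (v : EuclideanSpace ℝ (Fin k)) {w : Fin k → E} {B : ℝ}
    (hw : ∀ i, ‖w i‖ ≤ B) : ‖∑ i, v i • w i‖ ≤ k * ‖v‖ * B := by
  refine (norm_sum_le _ _).trans ?_
  have : ∀ i ∈ Finset.univ, ‖v i • w i‖ ≤ ‖v‖ * B := fun i _ => by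
    rw [norm_smul]
    exact mul_le_mul (PiLp.norm_apply_le v i) (hw i) (norm_nonneg _) (norm_nonneg _)
  refine (Finset.sum_le_card_nsmul _ _ _ this).trans_eq ?_
  simp [mul_assoc]

/-- Vector fields `G₁, …, G_k` that are Lipschitz with constant `L` and bounded by `C` at the
origin: the state dependence of an admissible field at a fixed parameter. -/
structure IsLipschitzFamily {E : Type*} [NormedAddCommGroup E] {k : ℕ} (G : Fin k → E → E)
    (L C : ℝ) : Prop where
  pos : 0 < L
  bound_nonneg : 0 ≤ C
  lipschitz : ∀ i x y, ‖G i x - G i y‖ ≤ L * ‖x - y‖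
  bound : ∀ i, ‖G i 0‖ ≤ C

namespace IsLipschitzFamily

variable {E : Type*} [NormedAddCommGroup E] [NormedSpace ℝ E] {k : ℕ} {G : Fin k → E → E}
  {L C T : ℝ}

theorem continuous {E : Type*} [NormedAddCommGroup E] {G : Fin k → E → E}
    (hG : IsLipschitzFamily G L C) (i : Fin k) : Continuous (G i) :=
  (LipschitzWith.of_dist_le_mul (K := ⟨L, hG.pos.le⟩) fun x y => by
    rw [dist_eq_norm, dist_eq_norm]; exact hG.lipschitz i x y).continuous

theorem aestronglyMeasurable (hG : IsLipschitzFamily G L C) {u : ℝ → EuclideanSpace ℝ (Fin k)}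
    (hu : IntegrableOn u (Icc 0 T)) {x : ℝ → E} (hx : ContinuousOn x (Icc 0 T)) :
    AEStronglyMeasurable (fun t => ∑ i, u t i • G i (x t)) (volume.restrict (Icc 0 T)) := by
  refine Finset.aestronglyMeasurable_fun_sum _ fun i _ => ?_
  exact ((EuclideanSpace.proj (𝕜 := ℝ) i).continuous.comp_aestronglyMeasurable
    hu.aestronglyMeasurable).smul
    (((hG.continuous i).comp_continuousOn hx).aestronglyMeasurable measurableSet_Icc)

theorem isCaratheodoryField (hG : IsLipschitzFamily G L C) {u : ℝ → EuclideanSpace ℝ (Fin k)}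
    (hu : IntegrableOn u (Icc 0 T)) :
    IsCaratheodoryField (fun t x => ∑ i, u t i • G i x) (fun t => k * L * ‖u t‖) T (C / L) where
  integrableOn := hu.norm.const_mul _
  nonneg t _ := by have := hG.pos; positivity
  const_nonneg := div_nonneg hG.bound_nonneg hG.pos.le
  lipschitz t _ x y := by
    rw [← Finset.sum_sub_distrib]
    simp only [← smul_sub]
    exact (norm_sum_smul_le (u t) fun i => hG.lipschitz i x y).trans_eq (by ring)
  bound t _ := by
    have := hG.pos
    refine (norm_sum_smul_le (u t) hG.bound).trans_eq ?_
    field_simp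
  measurable x hx := hG.aestronglyMeasurable hu hx

end IsLipschitzFamily

section Trajectory

variable {n k : ℕ} {Θ : Type*} {T : ℝ} {q : ℝ≥0∞}
  {F : Fin k → EuclideanSpace ℝ (Fin n) → Θ → EuclideanSpace ℝ (Fin n)}
  {x₀ : Θ → EuclideanSpace ℝ (Fin n)} {θ : Θ} {L C : ℝ}

theorem IsTrajectory.continuousOn {u : ℝ → EuclideanSpace ℝ (Fin k)}
    {x : ℝ → EuclideanSpace ℝ (Fin n)} (hT : 0 ≤ T) (h : IsTrajectory T F x₀ u θ x) :
    ContinuousOn x (Icc 0 T) := by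
  simpa only [uIcc_of_le hT] using h.absolutelyContinuous.continuousOn

theorem IsTrajectory.eq_integral {u : ℝ → EuclideanSpace ℝ (Fin k)}
    {x : ℝ → EuclideanSpace ℝ (Fin n)} (hT : 0 ≤ T)
    (hG : IsLipschitzFamily (fun i x => F i x θ) L C) (hu : IntegrableOn u (Icc 0 T))
    (h : IsTrajectory T F x₀ u θ x) :
    ∀ t ∈ Icc 0 T, x t = x₀ θ + ∫ s in (0 : ℝ)..t, ∑ i, u s i • F i (x s) θ := by
  have hi := intervalIntegrable_of_integrableOn_Icc
    ((hG.isCaratheodoryField hu).integrableOn_comp (h.continuousOn hT)) ⟨le_rfl, hT⟩ ⟨hT, le_rfl⟩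
  have := h.absolutelyContinuous.eq_add_integral hi (by
    rw [uIcc_of_le hT]
    exact (ae_restrict_iff' measurableSet_Icc).1 h.hasDerivAt)
  rwa [uIcc_of_le hT, h.initial] at this

theorem exists_isTrajectory {u : ℝ → EuclideanSpace ℝ (Fin k)} (hT : 0 ≤ T)
    (hG : IsLipschitzFamily (fun i x => F i x θ) L C) (hu : IntegrableOn u (Icc 0 T)) :
    ∃ x, IsTrajectory T F x₀ u θ x := by
  have hV := hG.isCaratheodoryField hu
  obtain ⟨x, hxc, -, hx⟩ := hV.exists_integral_solution (x₀ θ)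
  have hi := intervalIntegrable_of_integrableOn_Icc (hV.integrableOn_comp hxc)
    ⟨le_rfl, hT⟩ ⟨hT, le_rfl⟩
  -- outside `[0,T]` the solution is continued as the primitive of the velocity
  refine ⟨fun t => x₀ θ + ∫ s in (0 : ℝ)..t, ∑ i, u s i • F i (x s) θ, ?_, ?_, by simp⟩
  · refine hi.absolutelyContinuousOnInterval_primitive.of_dist_le fun s _ t _ => ?_
    rw [dist_add_left]
  · rw [ae_restrict_iff' measurableSet_Icc]
    filter_upwards [hi.ae_hasDerivAt_integral] with t ht htT
    have := (ht (by rwa [uIcc_of_le hT]) 0 left_mem_uIcc).const_add (x₀ θ)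
    simp only [← hx t htT]
    exact this

theorem isTrajectory_trajectory {u : ℝ → EuclideanSpace ℝ (Fin k)} (hT : 0 ≤ T)
    (hG : IsLipschitzFamily (fun i x => F i x θ) L C) (hu : IntegrableOn u (Icc 0 T)) :
    IsTrajectory T F x₀ u θ (trajectory T F x₀ u θ) := by
  have h := exists_isTrajectory (x₀ := x₀) hT hG hu
  rw [trajectory, dif_pos h]
  exact h.choose_spec

theorem IsTrajectory.eqOn {u : ℝ → EuclideanSpace ℝ (Fin k)}
    {x y : ℝ → EuclideanSpace ℝ (Fin n)} (hT : 0 ≤ T)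
    (hG : IsLipschitzFamily (fun i x => F i x θ) L C) (hu : IntegrableOn u (Icc 0 T))
    (hx : IsTrajectory T F x₀ u θ x) (hy : IsTrajectory T F x₀ u θ y) : EqOn x y (Icc 0 T) := by
  intro t ht
  have := (hG.isCaratheodoryField hu).norm_sub_le_of_integral_eq le_rfl (hx.continuousOn hT)
    (hy.continuousOn hT) (hx.eq_integral hT hG hu) (fun s hs => by
      rw [← hy.eq_integral hT hG hu s hs, sub_self, norm_zero]) t ht
  rw [mul_zero, zero_mul] at this
  exact sub_eq_zero.1 (norm_le_zero_iff.1 this)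

theorem tendsto_picardIterate_trajectory {u : ℝ → EuclideanSpace ℝ (Fin k)} (hT : 0 ≤ T)
    (hG : IsLipschitzFamily (fun i x => F i x θ) L C) (hu : IntegrableOn u (Icc 0 T)) {t : ℝ}
    (ht : t ∈ Icc 0 T) :
    Filter.Tendsto (fun j => picardIterate (fun s x => ∑ i, u s i • F i x θ) (x₀ θ) j t)
      Filter.atTop (nhds (trajectory T F x₀ u θ t)) := by
  have hV := hG.isCaratheodoryField hu
  obtain ⟨x, hxc, hlim, hx⟩ := hV.exists_integral_solution (x₀ θ)
  have htr := isTrajectory_trajectory (x₀ := x₀) hT hG hu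
  have := hV.norm_sub_le_of_integral_eq le_rfl hxc (htr.continuousOn hT) hx (fun s hs => by
      rw [← htr.eq_integral hT hG hu s hs, sub_self, norm_zero]) t ht
  rw [mul_zero, zero_mul] at this
  rw [← sub_eq_zero.1 (norm_le_zero_iff.1 this)]
  exact hlim t ht

/-- The growth factor `exp (2 k L T^(1-1/q) r)` of trajectories with controls of norm at most
`r`. -/
noncomputable def growthFactor (T L : ℝ) (k : ℕ) (q : ℝ≥0∞) (r : ℝ) : ℝ :=
  Real.exp (2 * (k * L * (T ^ (1 - 1 / q.toReal) * r)))

theorem exp_integral_le_growthFactor (hT : 0 ≤ T) (hL : 0 ≤ L) (hq : 1 ≤ q)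
    (u : ControlSpace T k q) {r : ℝ} (hu : ‖u‖ ≤ r) :
    Real.exp (2 * ∫ s in (0 : ℝ)..T, k * L * ‖u s‖) ≤ growthFactor T L k q r := by
  rw [growthFactor, intervalIntegral.integral_const_mul]
  have h1 := integral_norm_le_of_lp hq u le_rfl hT le_rfl
  rw [sub_zero] at h1
  have h2 : T ^ (1 - 1 / q.toReal) * ‖u‖ ≤ T ^ (1 - 1 / q.toReal) * r := by gcongr
  have h3 := h1.trans h2
  gcongr

theorem norm_trajectory_le (hT : 0 ≤ T) (hG : IsLipschitzFamily (fun i x => F i x θ) L C)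
    (hq : 1 ≤ q) (u : ControlSpace T k q) {r : ℝ} (hu : ‖u‖ ≤ r) {t : ℝ} (ht : t ∈ Icc 0 T) :
    ‖trajectory T F x₀ u θ t‖ ≤ 2 * (C / L + ‖x₀ θ‖) * growthFactor T L k q r := by
  have hui := lp_integrableOn hq u
  have htr := isTrajectory_trajectory (x₀ := x₀) hT hG hui
  refine ((hG.isCaratheodoryField hui).norm_le_of_integral_eq (htr.continuousOn hT)
    (htr.eq_integral hT hG hui) t ht).trans ?_
  have := div_nonneg hG.bound_nonneg hG.pos.le
  have := exp_integral_le_growthFactor hT hG.pos.le hq u hu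
  gcongr

/-! ### Weak convergence of controls and convergence of trajectories -/

/-- An equi-Hölder sequence that tends to zero pointwise on `[0,T]` tends to zero uniformly. -/
theorem eventually_forall_norm_le_of_equiHolder {E : Type*} [NormedAddCommGroup E]
    {z : ℕ → ℝ → E} {K γ : ℝ} (hγ : 0 < γ)
    (hz : ∀ j, ∀ s ∈ Icc 0 T, ∀ t ∈ Icc 0 T, ‖z j s - z j t‖ ≤ K * |s - t| ^ γ)
    (hlim : ∀ t ∈ Icc 0 T, Filter.Tendsto (fun j => z j t) Filter.atTop (nhds 0)) {ε : ℝ}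
    (hε : 0 < ε) : ∀ᶠ j in Filter.atTop, ∀ t ∈ Icc 0 T, ‖z j t‖ ≤ ε := by
  refine isCompact_Icc.induction_on (p := fun S => ∀ᶠ j in Filter.atTop, ∀ t ∈ S, ‖z j t‖ ≤ ε)
    (by simp) (fun S S' hS h => h.mono fun j hj t ht => hj t (hS ht))
    (fun S S' h h' => by
      filter_upwards [h, h'] with j hj hj' t ht using ht.elim (hj t) (hj' t)) fun t ht => ?_
  have hcont : Filter.Tendsto (fun s => K * |s - t| ^ γ) (nhdsWithin t (Icc 0 T)) (nhds 0) := by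
    have h1 : Continuous fun s : ℝ => K * |s - t| ^ γ :=
      continuous_const.mul ((continuous_abs.comp (continuous_id.sub continuous_const)).rpow_const
        fun _ => Or.inr hγ.le)
    have h2 := h1.tendsto t
    simp only [sub_self, abs_zero, Real.zero_rpow hγ.ne', mul_zero] at h2
    exact h2.mono_left nhdsWithin_le_nhds
  refine ⟨{s | K * |s - t| ^ γ < ε / 2} ∩ Icc 0 T,
    Filter.inter_mem (hcont.eventually (gt_mem_nhds (half_pos hε))) self_mem_nhdsWithin, ?_⟩
  have h3 := (hlim t ht).norm
  rw [norm_zero] at h3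
  filter_upwards [h3.eventually (gt_mem_nhds (half_pos hε))] with j hj s hs
  have h4 := hz j s hs.2 t ht
  have h5 : ‖z j s‖ ≤ ‖z j s - z j t‖ + ‖z j t‖ := by
    simpa using norm_add_le (z j s - z j t) (z j t)
  have h6 : K * |s - t| ^ γ < ε / 2 := hs.1
  linarith

/-- The linear map `w ↦ ∫₀ᵗ ∑ᵢ wᵢ(s) Gᵢ(x(s)) ds` along a continuous curve. -/
noncomputable def integralAlong (hq : 1 ≤ q) {G : Fin k → EuclideanSpace ℝ (Fin n) →
      EuclideanSpace ℝ (Fin n)} (hG : IsLipschitzFamily G L C)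
    {x : ℝ → EuclideanSpace ℝ (Fin n)} (hx : ContinuousOn x (Icc 0 T)) {t : ℝ}
    (ht : t ∈ Icc 0 T) : ControlSpace T k q →ₗ[ℝ] EuclideanSpace ℝ (Fin n) where
  toFun w := ∫ s in (0 : ℝ)..t, ∑ i, w s i • G i (x s)
  map_add' w w' := by
    have h0 : (0 : ℝ) ∈ Icc 0 T := ⟨le_rfl, ht.1.trans ht.2⟩
    have hi : ∀ w : ControlSpace T k q, IntervalIntegrable (fun s => ∑ i, w s i • G i (x s))
      volume 0 t := fun w => intervalIntegrable_of_integrableOn_Icc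
        ((hG.isCaratheodoryField (lp_integrableOn hq w)).integrableOn_comp hx) h0 ht
    rw [← intervalIntegral.integral_add (hi w) (hi w')]
    refine intervalIntegral.integral_congr_ae ?_
    filter_upwards [(ae_restrict_iff' measurableSet_Icc).1 (Lp.coeFn_add w w')] with s hs hst
    rw [uIoc_of_le ht.1] at hst
    rw [hs ⟨hst.1.le, hst.2.trans ht.2⟩]
    simp [add_smul, Finset.sum_add_distrib]
  map_smul' c w := by
    rw [RingHom.id_apply, ← intervalIntegral.integral_smul]
    refine intervalIntegral.integral_congr_ae ?_
    filter_upwards [(ae_restrict_iff' measurableSet_Icc).1 (Lp.coeFn_smul c w)] with s hs hst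
    rw [uIoc_of_le ht.1] at hst
    rw [hs ⟨hst.1.le, hst.2.trans ht.2⟩]
    simp [mul_smul, Finset.smul_sum]

theorem norm_integral_sum_sub_le (hq : 1 ≤ q) {G : Fin k → EuclideanSpace ℝ (Fin n) →
      EuclideanSpace ℝ (Fin n)} (hG : IsLipschitzFamily G L C)
    {x : ℝ → EuclideanSpace ℝ (Fin n)} (hx : ContinuousOn x (Icc 0 T)) {B : ℝ} (hB : 0 ≤ B)
    (hxB : ∀ i, ∀ s ∈ Icc 0 T, ‖G i (x s)‖ ≤ B) (w : ControlSpace T k q) {s t : ℝ}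
    (hs : s ∈ Icc 0 T) (ht : t ∈ Icc 0 T) :
    ‖(∫ r in (0 : ℝ)..s, ∑ i, w r i • G i (x r)) - ∫ r in (0 : ℝ)..t, ∑ i, w r i • G i (x r)‖ ≤
      k * B * (|s - t| ^ (1 - 1 / q.toReal) * ‖w‖) := by
  wlog hst : t ≤ s generalizing s t
  · rw [norm_sub_rev, abs_sub_comm]
    exact this ht hs (le_of_not_ge hst)
  have h0 : (0 : ℝ) ∈ Icc 0 T := ⟨le_rfl, ht.1.trans ht.2⟩
  have hi := (hG.isCaratheodoryField (lp_integrableOn hq w)).integrableOn_comp hx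
  rw [intervalIntegral.integral_interval_sub_left (intervalIntegrable_of_integrableOn_Icc hi h0 hs)
    (intervalIntegrable_of_integrableOn_Icc hi h0 ht), abs_of_nonneg (sub_nonneg.2 hst)]
  refine le_trans ?_ (mul_le_mul_of_nonneg_left
    (integral_norm_le_of_lp hq w ht.1 hst hs.2) (by positivity))
  rw [← intervalIntegral.integral_const_mul]
  refine intervalIntegral.norm_integral_le_of_norm_le hst (.of_forall fun r hr => ?_)
    ((intervalIntegrable_of_integrableOn_Icc (lp_integrableOn hq w).norm ht hs).const_mul _)
  exact (norm_sum_smul_le (w r) fun i => hxB i r ⟨ht.1.trans hr.1.le, hr.2.trans hs.2⟩).trans_eq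
    (by ring)

theorem IsLipschitzFamily.exists_bound_comp {G : Fin k → EuclideanSpace ℝ (Fin n) →
      EuclideanSpace ℝ (Fin n)} (hG : IsLipschitzFamily G L C)
    {x : ℝ → EuclideanSpace ℝ (Fin n)} (hx : ContinuousOn x (Icc 0 T)) :
    ∃ B, 0 ≤ B ∧ ∀ i, ∀ s ∈ Icc 0 T, ‖G i (x s)‖ ≤ B := by
  obtain ⟨B, hB⟩ := isCompact_Icc.exists_bound_of_continuousOn
    (f := fun s => WithLp.toLp 2 fun i => (G i (x s)))
    ((PiLp.continuous_toLp 2 _).comp_continuousOn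
      (continuousOn_pi.2 fun i => (hG.continuous i).comp_continuousOn hx))
  refine ⟨max B 0, le_max_right _ _, fun i s hs => ?_⟩
  exact (PiLp.norm_apply_le (WithLp.toLp 2 fun i => (G i (x s))) i).trans
    ((hB s hs).trans (le_max_left _ _))

/-- Along a bounded weakly convergent sequence of controls the trajectories converge on `[0,T]`: the
limit trajectory solves the approximating integral equations up to an error that tends to zero
pointwise, by weak convergence, and hence uniformly, by equicontinuity. -/
theorem tendsto_trajectory (hT : 0 ≤ T) (hq : 1 < q) (hq_top : q ≠ ∞) [Fact (1 ≤ q)]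
    (hG : IsLipschitzFamily (fun i x => F i x θ) L C) {u : ℕ → ControlSpace T k q}
    {v : ControlSpace T k q} {r : ℝ} (hu : ∀ j, ‖u j‖ ≤ r)
    (huv : ∀ φ : StrongDual ℝ (ControlSpace T k q),
      Filter.Tendsto (fun j => φ (u j)) Filter.atTop (nhds (φ v))) {t : ℝ} (ht : t ∈ Icc 0 T) :
    Filter.Tendsto (fun j => trajectory T F x₀ (u j) θ t) Filter.atTop
      (nhds (trajectory T F x₀ v θ t)) := by
  have htr := fun w : ControlSpace T k q =>
    isTrajectory_trajectory (x₀ := x₀) hT hG (lp_integrableOn hq.le w)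
  have hxc := (htr v).continuousOn hT
  set x := trajectory T F x₀ v θ with hx_def
  obtain ⟨B, hB, hxB⟩ := hG.exists_bound_comp hxc
  have hγ : 0 < 1 - 1 / q.toReal := by
    have h1 : 1 < q.toReal := by
      simpa using (ENNReal.toReal_lt_toReal ENNReal.one_ne_top hq_top).2 hq
    rw [sub_pos]
    exact (div_lt_one (by linarith)).2 h1
  have h0 : (0 : ℝ) ∈ Icc 0 T := ⟨le_rfl, hT⟩
  set z : ℕ → ℝ → EuclideanSpace ℝ (Fin n) := fun j s =>
    ∫ r in (0 : ℝ)..s, ∑ i, (u j - v) r i • F i (x r) θ with hz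
  have hzHolder : ∀ j, ∀ s ∈ Icc 0 T, ∀ t ∈ Icc 0 T,
      ‖z j s - z j t‖ ≤ (k * B * (r + ‖v‖)) * |s - t| ^ (1 - 1 / q.toReal) := fun j s hs t ht => by
    refine (norm_integral_sum_sub_le hq.le hG hxc hB hxB (u j - v) hs ht).trans ?_
    have h1 : ‖u j - v‖ ≤ r + ‖v‖ := (norm_sub_le _ _).trans (by linarith [hu j])
    calc k * B * (|s - t| ^ (1 - 1 / q.toReal) * ‖u j - v‖)
        ≤ k * B * (|s - t| ^ (1 - 1 / q.toReal) * (r + ‖v‖)) := by gcongr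
      _ = _ := by ring
  have hzlim : ∀ s ∈ Icc 0 T, Filter.Tendsto (fun j => z j s) Filter.atTop (nhds 0) := by
    intro s hs
    set Λ : ControlSpace T k q →L[ℝ] EuclideanSpace ℝ (Fin n) :=
      (integralAlong hq.le hG hxc hs).mkContinuous (k * B * |s - 0| ^ (1 - 1 / q.toReal))
        (fun w => by
          have := norm_integral_sum_sub_le hq.le hG hxc hB hxB w hs h0
          rw [intervalIntegral.integral_same, sub_zero] at this
          exact this.trans_eq (by ring)) with hΛ
    have h1 : Filter.Tendsto (fun j => Λ (u j)) Filter.atTop (nhds (Λ v)) := by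
      rw [(PiLp.homeomorph 2 (fun _ : Fin n => ℝ)).isEmbedding.tendsto_nhds_iff, tendsto_pi_nhds]
      exact fun i => huv ((EuclideanSpace.proj i).comp Λ)
    have h2 := h1.sub_const (Λ v)
    rw [sub_self] at h2
    refine h2.congr fun j => ?_
    rw [← map_sub]; rfl
  rw [Metric.tendsto_atTop']
  intro ε hε
  set M := growthFactor T L k q r with hM
  have hMpos : 0 < M := Real.exp_pos _
  have hev := eventually_forall_norm_le_of_equiHolder hγ hzHolder hzlim (ε := ε / (4 * M))
    (by positivity)
  obtain ⟨N, hN⟩ := Filter.eventually_atTop.1 hev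
  refine ⟨N, fun j hj => ?_⟩
  have hV := hG.isCaratheodoryField (lp_integrableOn hq.le (u j))
  have key := hV.norm_sub_le_of_integral_eq (x₀ := x₀ θ) (δ := ε / (4 * M)) (by positivity)
    ((htr (u j)).continuousOn hT) hxc ((htr (u j)).eq_integral hT hG (lp_integrableOn hq.le (u j)))
    (fun s hs => by
      have h1 : x s = x₀ θ + ∫ r in (0 : ℝ)..s, ∑ i, v r i • F i (x r) θ :=
        (htr v).eq_integral hT hG (lp_integrableOn hq.le v) s hs
      have h2 : z j s =
          (integralAlong hq.le hG hxc hs) (u j) - (integralAlong hq.le hG hxc hs) v := by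
        rw [← map_sub]; rfl
      have h3 : x s - (x₀ θ + ∫ r in (0 : ℝ)..s, ∑ i, u j r i • F i (x r) θ) = - z j s := by
        rw [h2]
        change x s - _ = -((∫ r in (0 : ℝ)..s, ∑ i, u j r i • F i (x r) θ) -
          ∫ r in (0 : ℝ)..s, ∑ i, v r i • F i (x r) θ)
        conv_lhs => rw [h1]
        abel
      rw [h3, norm_neg]
      exact hN j hj.le s hs) t ht
  rw [dist_eq_norm]
  have hexp := exp_integral_le_growthFactor hT hG.pos.le hq.le (u j) (hu j)
  calc ‖trajectory T F x₀ (u j) θ t - x t‖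
      ≤ 2 * (ε / (4 * M)) * Real.exp (2 * ∫ s in (0 : ℝ)..T, k * L * ‖u j s‖) := key
    _ ≤ 2 * (ε / (4 * M)) * M := by gcongr
    _ = ε / 2 := by field_simp; ring
    _ < ε := half_lt_self hε

end Trajectory

/-! ### Measurable dependence of trajectories on the parameter -/

theorem measurable_primitive {Θ E : Type*} [MeasurableSpace Θ] [NormedAddCommGroup E]
    [NormedSpace ℝ E] [MeasurableSpace E] [BorelSpace E] [SecondCountableTopology E]
    {h : ℝ → Θ → E} (hh : Measurable (Function.uncurry h)) :
    Measurable (fun z : ℝ × Θ => ∫ s in (0 : ℝ)..z.1, h s z.2) := by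
  have hmeas : Measurable fun p : (ℝ × Θ) × ℝ => h p.2 p.1.2 :=
    hh.comp (measurable_snd.prodMk (measurable_snd.comp measurable_fst))
  have h1 : MeasurableSet {p : (ℝ × Θ) × ℝ | p.2 ∈ Ioc 0 p.1.1} :=
    (measurableSet_lt measurable_const measurable_snd).inter
      (measurableSet_le measurable_snd (measurable_fst.comp measurable_fst))
  have h2 : MeasurableSet {p : (ℝ × Θ) × ℝ | p.2 ∈ Ioc p.1.1 0} :=
    (measurableSet_lt (measurable_fst.comp measurable_fst) measurable_snd).inter
      (measurableSet_le measurable_snd measurable_const)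
  have e : (fun z : ℝ × Θ => ∫ s in (0 : ℝ)..z.1, h s z.2) = fun z : ℝ × Θ =>
      (∫ s, {p : (ℝ × Θ) × ℝ | p.2 ∈ Ioc 0 p.1.1}.indicator (fun p => h p.2 p.1.2) (z, s)) -
      ∫ s, {p : (ℝ × Θ) × ℝ | p.2 ∈ Ioc p.1.1 0}.indicator (fun p => h p.2 p.1.2) (z, s) := by
    ext z
    rw [intervalIntegral, ← integral_indicator measurableSet_Ioc,
      ← integral_indicator measurableSet_Ioc]
    rfl
  rw [e]
  exact ((hmeas.indicator h1).stronglyMeasurable.integral_prod_right').measurable.sub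
    ((hmeas.indicator h2).stronglyMeasurable.integral_prod_right').measurable

section RandomCost

variable {n k : ℕ} {Θ : Type*} [MeasurableSpace Θ] {μ : Measure Θ} {T : ℝ} {q : ℝ≥0∞}
  {F : Fin k → EuclideanSpace ℝ (Fin n) → Θ → EuclideanSpace ℝ (Fin n)}
  {x₀ : Θ → EuclideanSpace ℝ (Fin n)} {a : ℝ → EuclideanSpace ℝ (Fin n) → Θ → ℝ}
  {ν : Measure ℝ} {p₀ p₁ : ℝ}

theorem measurable_picardIterate
    (hF : ∀ i, Measurable (fun z : EuclideanSpace ℝ (Fin n) × Θ => F i z.1 z.2))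
    {u : ℝ → EuclideanSpace ℝ (Fin k)} (hu : Measurable u) (hx₀ : Measurable x₀) (j : ℕ) :
    Measurable (fun z : ℝ × Θ =>
      picardIterate (fun s x => ∑ i, u s i • F i x z.2) (x₀ z.2) j z.1) := by
  induction j with
  | zero => exact hx₀.comp measurable_snd
  | succ j ih =>
    refine (hx₀.comp measurable_snd).add (measurable_primitive
      (h := fun s θ => ∑ i, u s i • F i
        (picardIterate (fun s x => ∑ i, u s i • F i x θ) (x₀ θ) j s) θ) ?_)
    refine Finset.measurable_fun_sum _ fun i _ => ?_
    have h1 : Measurable fun z : ℝ × Θ => u z.1 i :=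
      (EuclideanSpace.proj (𝕜 := ℝ) i).continuous.measurable.comp (hu.comp measurable_fst)
    exact h1.smul ((hF i).comp (ih.prodMk measurable_snd))

theorem IsAdmissibleField.exists_isLipschitzFamily (hF : IsAdmissibleField μ F) :
    ∃ L C : ℝ, ∀ᵐ θ ∂μ, IsLipschitzFamily (fun i x => F i x θ) L C := by
  obtain ⟨L, hL, h1⟩ := hF.lipschitz
  obtain ⟨C, hC, h2⟩ := hF.bounded
  refine ⟨L, C, ?_⟩
  filter_upwards [h1, h2] with θ h1 h2 using ⟨hL, hC.le, h1, h2⟩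

theorem continuousOn_integrand_trajectory {Θ : Type*}
    {F : Fin k → EuclideanSpace ℝ (Fin n) → Θ → EuclideanSpace ℝ (Fin n)}
    {x₀ : Θ → EuclideanSpace ℝ (Fin n)} {a : ℝ → EuclideanSpace ℝ (Fin n) → Θ → ℝ} {L C : ℝ}
    {θ : Θ} (hT : 0 ≤ T)
    (hG : IsLipschitzFamily (fun i x => F i x θ) L C)
    (ha : ContinuousOn (fun z : ℝ × EuclideanSpace ℝ (Fin n) => a z.1 z.2 θ) (Icc 0 T ×ˢ univ))
    {u : ℝ → EuclideanSpace ℝ (Fin k)} (hu : IntegrableOn u (Icc 0 T)) :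
    ContinuousOn (fun t => a t (trajectory T F x₀ u θ t) θ) (Icc 0 T) :=
  ha.comp (continuousOn_id.prodMk ((isTrajectory_trajectory (x₀ := x₀) hT hG hu).continuousOn hT))
    fun _ ht => ⟨ht, mem_univ _⟩

theorem aestronglyMeasurable_randomCost [IsFiniteMeasure ν] (hT : 0 ≤ T) (hq : 1 ≤ q)
    (hF : IsAdmissibleField μ F) (hx₀ : AEStronglyMeasurable x₀ μ)
    (ha : IsAdmissibleIntegrand μ T p₁ a) (u : ControlSpace T k q) :
    AEStronglyMeasurable (randomCost T F x₀ ν a u) μ := by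
  obtain ⟨L, C, hG⟩ := hF.exists_isLipschitzFamily
  -- time is projected to `[0,T]`, so that continuity holds on the whole space
  obtain ⟨b, hbm, hb⟩ := exists_measurable_uncurry_of_continuous (μ := μ)
    (b := fun (z : ℝ × EuclideanSpace ℝ (Fin n)) θ => a (projIcc 0 T hT z.1) z.2 θ)
    (fun z => ha.measurable _ (projIcc 0 T hT z.1).2 z.2) (by
      filter_upwards [ha.continuousOn] with θ hθ
      exact hθ.comp_continuous (f := fun z : ℝ × EuclideanSpace ℝ (Fin n) =>
        ((projIcc 0 T hT z.1 : ℝ), z.2)) (by fun_prop)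
        fun z => ⟨(projIcc 0 T hT z.1).2, mem_univ _⟩)
  set X : ℝ × Θ → EuclideanSpace ℝ (Fin n) := fun z => Filter.limUnder Filter.atTop fun j =>
    picardIterate (fun s x => ∑ i, u s i • F i x z.2) (hx₀.mk x₀ z.2) j z.1 with hX
  have hXm : Measurable X := (StronglyMeasurable.limUnder fun j =>
    (measurable_picardIterate hF.measurable (Lp.stronglyMeasurable u).measurable
      hx₀.stronglyMeasurable_mk.measurable j).stronglyMeasurable).measurable
  have hJ : StronglyMeasurable fun θ => ∫ t in Icc 0 T, b (t, X (t, θ)) θ ∂ν := by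
    refine StronglyMeasurable.integral_prod_right' (f := fun p : Θ × ℝ =>
      b (p.2, X (p.2, p.1)) p.1) (Measurable.stronglyMeasurable ?_)
    exact hbm.comp ((measurable_snd.prodMk (hXm.comp measurable_swap)).prodMk measurable_fst)
  refine ⟨_, hJ, ?_⟩
  filter_upwards [hG, hb, hx₀.ae_eq_mk] with θ hG hb hx
  refine setIntegral_congr_fun measurableSet_Icc fun t ht => ?_
  have h1 : X (t, θ) = trajectory T F x₀ u θ t := by
    rw [hX]
    simp only [← hx]
    exact (tendsto_picardIterate_trajectory hT hG (lp_integrableOn hq u) ht).limUnder_eq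
  change a t _ θ = b (t, X (t, θ)) θ
  rw [h1, ← hb]
  simp only
  rw [projIcc_of_mem hT ht]

/-! ### Domination of the random cost -/

/-- The integrand along trajectories with controls of norm at most `r` is dominated by an integrable
function of the parameter. -/
theorem exists_integrable_bound [IsFiniteMeasure μ] (hT : 0 ≤ T) (hq : 1 ≤ q)
    (hF : IsAdmissibleField μ F) (hp₁ : 2 < p₁) (hp : p₁ ≤ p₀)
    (hx₀ : MemLp x₀ (ENNReal.ofReal p₀) μ)
    (ha : IsAdmissibleIntegrand μ T p₁ a) (r : ℝ) :
    ∃ D : Θ → ℝ, Integrable D μ ∧ ∀ᵐ θ ∂μ, ∀ u : ControlSpace T k q, ‖u‖ ≤ r →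
      ∀ t ∈ Icc 0 T, |a t (trajectory T F x₀ u θ t) θ| ≤ D θ := by
  obtain ⟨L, C, hG⟩ := hF.exists_isLipschitzFamily
  obtain ⟨K, g, hK, hg0, hg, hlip⟩ := ha.lipschitz
  set S : Θ → ℝ := fun θ => ⨆ t : Icc (0 : ℝ) T, |a t 0 θ| with hS
  set Y : Θ → ℝ := fun θ => 2 * (C / L + ‖x₀ θ‖) * growthFactor T L k q r with hYdef
  have hY : MemLp Y (ENNReal.ofReal p₁) μ := by
    have h1 : MemLp (fun θ => ‖x₀ θ‖) (ENNReal.ofReal p₁) μ :=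
      (hx₀.mono_exponent (ENNReal.ofReal_le_ofReal hp)).norm
    have h2 := (((memLp_const (C / L)).add h1).const_mul 2).mul_const (growthFactor T L k q r)
    exact h2
  have hYp : Integrable (fun θ => ‖Y θ‖ ^ p₁) μ := by
    have := hY.integrable_norm_rpow (by simpa using (by linarith : 0 < p₁)) ENNReal.ofReal_ne_top
    rwa [ENNReal.toReal_ofReal (by linarith)] at this
  have hgY : Integrable (fun θ => g θ * Y θ) μ := by
    have hc : (p₁ / (p₁ - 1)).HolderConjugate p₁ :=
      (Real.HolderConjugate.conjExponent (by linarith : 1 < p₁)).symm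
    have := hc.ennrealOfReal
    exact hg.integrable_mul hY
  refine ⟨fun θ => S θ + (K * ‖Y θ‖ ^ p₁ + 2 * (g θ * Y θ)),
    (memLp_one_iff_integrable.1 ha.integrable_zero).add
      ((hYp.const_mul K).add (hgY.const_mul 2)), ?_⟩
  filter_upwards [hG, hlip, ha.continuousOn] with θ hG hlip hcont u hu t ht
  set x := trajectory T F x₀ u θ t with hx
  have hxY : ‖x‖ ≤ Y θ := norm_trajectory_le hT hG hq u hu ht
  have hY0 : 0 ≤ Y θ := (norm_nonneg _).trans hxY
  have h1 := hlip t ht x 0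
  rw [norm_zero, Real.zero_rpow (by linarith), mul_zero, zero_add, sub_zero] at h1
  have h2 : (K * ‖x‖ ^ (p₁ - 1) + g θ + g θ) * ‖x‖ ≤
      (K * Y θ ^ (p₁ - 1) + g θ + g θ) * Y θ := by
    have h3 : ‖x‖ ^ (p₁ - 1) ≤ Y θ ^ (p₁ - 1) :=
      Real.rpow_le_rpow (norm_nonneg _) hxY (by linarith)
    have := hg0 θ
    gcongr
  have h3 : Y θ ^ (p₁ - 1) * Y θ = ‖Y θ‖ ^ p₁ := by
    rw [Real.norm_of_nonneg hY0, ← Real.rpow_add_one' hY0 (by linarith), sub_add_cancel]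
  have h4 : |a t 0 θ| ≤ S θ := by
    have hc : ContinuousOn (fun t => |a t 0 θ|) (Icc 0 T) :=
      (hcont.comp (continuousOn_id.prodMk continuousOn_const) fun s hs => ⟨hs, mem_univ _⟩).abs
    have hbdd : BddAbove (range fun t : Icc (0 : ℝ) T => |a t 0 θ|) := by
      have := isCompact_Icc.bddAbove_image hc
      rwa [image_eq_range] at this
    exact le_ciSup hbdd ⟨t, ht⟩
  have h5 : |a t x θ| ≤ |a t x θ - a t 0 θ| + |a t 0 θ| := by
    simpa using abs_add_le (a t x θ - a t 0 θ) (a t 0 θ)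
  have h6 : (K * Y θ ^ (p₁ - 1) + g θ + g θ) * Y θ = K * ‖Y θ‖ ^ p₁ + 2 * (g θ * Y θ) := by
    rw [← h3]; ring
  linarith

theorem exists_integrable_bound_randomCost [IsFiniteMeasure μ] [IsFiniteMeasure ν] (hT : 0 ≤ T)
    (hq : 1 ≤ q) (hF : IsAdmissibleField μ F) (hp₁ : 2 < p₁) (hp : p₁ ≤ p₀)
    (hx₀ : MemLp x₀ (ENNReal.ofReal p₀) μ)
    (ha : IsAdmissibleIntegrand μ T p₁ a) (r : ℝ) :
    ∃ D : Θ → ℝ, Integrable D μ ∧ ∀ u : ControlSpace T k q, ‖u‖ ≤ r →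
      ∀ᵐ θ ∂μ, ‖randomCost T F x₀ ν a u θ‖ ≤ D θ := by
  obtain ⟨D, hD, hbound⟩ := exists_integrable_bound (k := k) hT hq hF hp₁ hp hx₀ ha r
  refine ⟨fun θ => D θ * ν.real (Icc 0 T), hD.mul_const _, fun u hu => ?_⟩
  filter_upwards [hbound] with θ hθ
  exact norm_setIntegral_le_of_norm_le_const (measure_lt_top _ _) fun t ht => hθ u hu t ht

theorem memLp_randomCost [IsFiniteMeasure μ] [IsFiniteMeasure ν] (hT : 0 ≤ T) (hq : 1 ≤ q)
    (hF : IsAdmissibleField μ F) (hp₁ : 2 < p₁) (hp : p₁ ≤ p₀)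
    (hx₀ : MemLp x₀ (ENNReal.ofReal p₀) μ)
    (ha : IsAdmissibleIntegrand μ T p₁ a) (u : ControlSpace T k q) :
    MemLp (randomCost T F x₀ ν a u) 1 μ := by
  obtain ⟨D, hD, hbound⟩ := exists_integrable_bound_randomCost (k := k) (ν := ν) hT hq hF hp₁ hp
    hx₀ ha ‖u‖
  exact memLp_one_iff_integrable.2 (hD.mono'
    (aestronglyMeasurable_randomCost hT hq hF hx₀.aestronglyMeasurable ha u) (hbound u le_rfl))

/-- Along bounded weakly convergent sequences of controls the random costs converge almost
everywhere. -/
theorem ae_tendsto_randomCost [IsFiniteMeasure μ] [IsFiniteMeasure ν] (hT : 0 ≤ T) (hq : 1 < q)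
    (hq_top : q ≠ ∞) [Fact (1 ≤ q)]
    (hF : IsAdmissibleField μ F) (hp₁ : 2 < p₁) (hp : p₁ ≤ p₀)
    (hx₀ : MemLp x₀ (ENNReal.ofReal p₀) μ)
    (ha : IsAdmissibleIntegrand μ T p₁ a) {u : ℕ → ControlSpace T k q}
    {v : ControlSpace T k q} {r : ℝ} (hu : ∀ j, ‖u j‖ ≤ r)
    (huv : ∀ φ : StrongDual ℝ (ControlSpace T k q),
      Filter.Tendsto (fun j => φ (u j)) Filter.atTop (nhds (φ v))) :
    ∀ᵐ θ ∂μ, Filter.Tendsto (fun j => randomCost T F x₀ ν a (u j) θ) Filter.atTop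
      (nhds (randomCost T F x₀ ν a v θ)) := by
  obtain ⟨L, C, hG⟩ := hF.exists_isLipschitzFamily
  obtain ⟨D, hD, hbound⟩ := exists_integrable_bound (k := k) hT hq.le hF hp₁ hp hx₀ ha r
  filter_upwards [hG, hbound, ha.continuousOn] with θ hG hbound hcont
  refine tendsto_integral_of_dominated_convergence (fun _ => D θ) (fun j => ?_)
    (integrable_const _) (fun j => ?_) ?_
  · exact (continuousOn_integrand_trajectory hT hG hcont
      (lp_integrableOn hq.le (u j))).aestronglyMeasurable measurableSet_Icc
  · exact (ae_restrict_iff' measurableSet_Icc).2 (.of_forall fun t ht => hbound (u j) (hu j) t ht)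
  · refine (ae_restrict_iff' measurableSet_Icc).2 (.of_forall fun t ht => ?_)
    exact (hcont (t, trajectory T F x₀ v θ t) ⟨ht, mem_univ _⟩).tendsto.comp
      (tendsto_nhdsWithin_iff.2 ⟨(tendsto_const_nhds (x := t)).prodMk_nhds
        (tendsto_trajectory hT hq hq_top hG hu huv ht), .of_forall fun j => ⟨ht, mem_univ _⟩⟩)

theorem tendsto_reducedCost [IsFiniteMeasure μ] [IsFiniteMeasure ν] (hT : 0 ≤ T) (hq : 1 < q)
    (hq_top : q ≠ ∞) [Fact (1 ≤ q)]
    (hF : IsAdmissibleField μ F) (hp₁ : 2 < p₁) (hp : p₁ ≤ p₀)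
    (hx₀ : MemLp x₀ (ENNReal.ofReal p₀) μ)
    (ha : IsAdmissibleIntegrand μ T p₁ a) {u : ℕ → ControlSpace T k q}
    {v : ControlSpace T k q} {r : ℝ} (hu : ∀ j, ‖u j‖ ≤ r)
    (huv : ∀ φ : StrongDual ℝ (ControlSpace T k q),
      Filter.Tendsto (fun j => φ (u j)) Filter.atTop (nhds (φ v))) :
    Filter.Tendsto (fun j => reducedCost μ T F x₀ ν a (u j)) Filter.atTop
      (nhds (reducedCost μ T F x₀ ν a v)) := by
  have hmem := fun w : ControlSpace T k q => memLp_randomCost (ν := ν) hT hq.le hF hp₁ hp hx₀ ha w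
  obtain ⟨D, hD, hbound⟩ := exists_integrable_bound_randomCost (k := k) (ν := ν) hT hq.le hF hp₁ hp
    hx₀ ha r
  have hlim := ae_tendsto_randomCost (ν := ν) hT hq hq_top hF hp₁ hp hx₀ ha hu huv
  simp only [reducedCost, hmem, dif_pos]
  rw [Lp.tendsto_Lp_iff_tendsto_eLpNorm'']
  have := tendsto_lintegral_norm_of_dominated_convergence (fun j => (hmem (u j)).1) hD.2
    (fun j => hbound (u j) (hu j)) hlim
  simpa [eLpNorm_one_eq_lintegral_enorm, Real.enorm_eq_ofReal_abs] using this

theorem const_le_reducedCost [IsFiniteMeasure μ] [IsFiniteMeasure ν] (hT : 0 ≤ T) (hq : 1 ≤ q)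
    (hF : IsAdmissibleField μ F) (hp₁ : 2 < p₁) (hp : p₁ ≤ p₀)
    (hx₀ : MemLp x₀ (ENNReal.ofReal p₀) μ)
    (ha : IsAdmissibleIntegrand μ T p₁ a) :
    ∃ c : ℝ, ∀ u : ControlSpace T k q,
      ∀ᵐ θ ∂μ, Lp.const 1 μ c θ ≤ reducedCost μ T F x₀ ν a u θ := by
  obtain ⟨L, C, hG⟩ := hF.exists_isLipschitzFamily
  obtain ⟨c, hc⟩ := ha.bddBelow
  refine ⟨ν.real (Icc 0 T) * c, fun u => ?_⟩
  have hmem := memLp_randomCost (ν := ν) hT hq hF hp₁ hp hx₀ ha u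
  rw [reducedCost, dif_pos hmem]
  filter_upwards [Lp.coeFn_const (p := 1) (μ := μ) (ν.real (Icc 0 T) * c), hmem.coeFn_toLp, hG, hc,
    ha.continuousOn] with θ h1 h2 hG hc hcont
  rw [h1, h2, Function.const_apply, randomCost]
  have hi : IntegrableOn (fun t => a t (trajectory T F x₀ u θ t) θ) (Icc 0 T) ν :=
    (continuousOn_integrand_trajectory hT hG hcont (lp_integrableOn hq u)).integrableOn_compact
      isCompact_Icc
  have := setIntegral_mono_on (integrable_const c) hi measurableSet_Icc fun t ht => hc t ht _
  simpa using this

end RandomCost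

/-! ### The direct method -/

theorem IsControlCost.exists_norm_le {k : ℕ} {T : ℝ} {q : ℝ≥0∞}
    {f : ℝ → EuclideanSpace ℝ (Fin k) → ℝ} (hf : IsControlCost T q f) (hq : 1 ≤ q) (hq_top : q ≠ ∞)
    (B : ℝ) : ∃ r, ∀ u : ControlSpace T k q, controlCost T f u ≤ B → ‖u‖ ≤ r := by
  obtain ⟨C, c, hC, hcoer⟩ := hf.exists_coercive (zero_lt_one.trans_le hq).ne' hq_top
  have hq1 : 1 ≤ q.toReal := by
    simpa using (ENNReal.toReal_le_toReal ENNReal.one_ne_top hq_top).2 hq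
  refine ⟨max 1 ((B + c) / C), fun u hu => ?_⟩
  rcases le_or_gt ‖u‖ 1 with h | h
  · exact h.trans (le_max_left _ _)
  · refine le_trans ?_ (le_max_right _ _)
    rw [le_div_iff₀ hC]
    have h1 := Real.self_le_rpow_of_one_le h.le hq1
    have h2 := hcoer u
    nlinarith

theorem le_liminf_of_forall_lt_eventually {y : EReal} {w : ℕ → EReal}
    (h : ∀ c < y, ∀ᶠ j in Filter.atTop, c < w j) : y ≤ Filter.liminf w Filter.atTop :=
  le_of_forall_lt_imp_le_of_dense fun c hc =>
    Filter.le_liminf_of_le (by isBoundedDefault) ((h c hc).mono fun _ hj => hj.le)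

theorem mainTheorem1 {n k : ℕ} {Θ : Type*} [MetricSpace Θ] [MeasurableSpace Θ] [BorelSpace Θ]
    (μ : Measure Θ) [IsProbabilityMeasure μ] (T : ℝ) (hT : 0 < T)
    (q : ℝ≥0∞) [Fact (1 ≤ q)] (hq : 1 < q) (hq_top : q < ⊤)
    (U : Set (ControlSpace T k q)) (hU : U.Nonempty) (hU_closed : IsWeaklyClosed U)
    (F : Fin k → EuclideanSpace ℝ (Fin n) → Θ → EuclideanSpace ℝ (Fin n))
    (hF : IsAdmissibleField μ F)
    (p₀ p₁ : ℝ) (hp₀ : 4 < p₀) (hp₁ : p₁ ∈ Ioc 2 (p₀ / 2))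
    (x₀ : Θ → EuclideanSpace ℝ (Fin n)) (hx₀ : MemLp x₀ (ENNReal.ofReal p₀) μ)
    (ν : Measure ℝ) [IsFiniteMeasure ν]
    (a : ℝ → EuclideanSpace ℝ (Fin n) → Θ → ℝ) (ha : IsAdmissibleIntegrand μ T p₁ a)
    (R : Lp ℝ 1 μ → EReal) (hR : IsRiskMeasure μ R)
    (f : ℝ → EuclideanSpace ℝ (Fin k) → ℝ) (hf : IsControlCost T q f)
    (α : ℝ) (hα : 0 < α) :
    -- the trajectories exist and are unique on `[0,T]`, and the costs are well defined
    (∀ᵐ θ ∂μ, ∀ u : ControlSpace T k q, (∃ x, IsTrajectory T F x₀ u θ x) ∧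
      (∀ x y, IsTrajectory T F x₀ u θ x → IsTrajectory T F x₀ u θ y → EqOn x y (Icc 0 T)) ∧
      IntegrableOn (fun t => a t (trajectory T F x₀ u θ t) θ) (Icc 0 T) ν) ∧
    (∀ u : ControlSpace T k q, MemLp (randomCost T F x₀ ν a u) 1 μ) ∧
    (∀ u : ControlSpace T k q, IntegrableOn (fun t => f t (u t)) (Icc 0 T)) ∧
    -- the objective attains its infimum over the admissible controls
    ∃ uStar ∈ U, objective μ T F x₀ ν a R f α uStar = ⨅ u ∈ U, objective μ T F x₀ ν a R f α u := by

  have hq0 : q ≠ 0 := (zero_lt_one.trans hq).ne'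
  have hp : p₁ ≤ p₀ := hp₁.2.trans (by linarith)
  refine ⟨?_, fun u => memLp_randomCost hT.le hq.le hF hp₁.1 hp hx₀ ha u,
    fun u => hf.integrableOn hq0 hq_top.ne u, ?_⟩
  · obtain ⟨L, C, hG⟩ := hF.exists_isLipschitzFamily
    filter_upwards [hG, ha.continuousOn] with θ hG hcont u
    have hu := lp_integrableOn hq.le u
    exact ⟨exists_isTrajectory hT.le hG hu, fun x y hx hy => hx.eqOn hT.le hG hu hy,
      (continuousOn_integrand_trajectory hT.le hG hcont hu).integrableOn_compact isCompact_Icc⟩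
  set I : ControlSpace T k q → EReal := fun u => objective μ T F x₀ ν a R f α u with hI
  change ∃ uStar ∈ U, I uStar = ⨅ u ∈ U, I u
  set m : EReal := ⨅ u ∈ U, I u with hm
  rcases eq_or_ne m ⊤ with hm_top | hm_top
  · obtain ⟨u₀, hu₀⟩ := hU
    refine ⟨u₀, hu₀, le_antisymm (hm_top ▸ le_top) (iInf₂_le u₀ hu₀)⟩
  -- a minimizing sequence with values below a real number
  obtain ⟨M, hmM, -⟩ := EReal.lt_iff_exists_real_btwn.1 hm_top.lt_top
  obtain ⟨w, -, hwlim, hwU⟩ := exists_seq_tendsto_sInf (hU.image I) (OrderBot.bddBelow _)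
  rw [sInf_image] at hwlim
  obtain ⟨N, hN⟩ := Filter.eventually_atTop.1 (hwlim.eventually (gt_mem_nhds hmM))
  choose u₁ hu₁U hu₁I using hwU
  set u : ℕ → ControlSpace T k q := fun j => u₁ (j + N) with hu_def
  have huU : ∀ j, u j ∈ U := fun j => hu₁U _
  have huM : ∀ j, I (u j) < M := fun j => by
    rw [hu_def]; simp only [hu₁I]; exact hN _ (Nat.le_add_left _ _)
  have hulim : Filter.Tendsto (fun j => I (u j)) Filter.atTop (nhds m) := by
    simp only [hu_def, hu₁I]
    exact hwlim.comp (Filter.tendsto_add_atTop_nat N)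
  -- monotonicity of the risk measure bounds the risk from below, and coercivity of the control
  -- cost then bounds the minimizing sequence
  obtain ⟨c, hc⟩ := const_le_reducedCost (k := k) (q := q) (ν := ν) hT.le hq.le hF hp₁.1 hp hx₀ ha
  obtain ⟨b, hb⟩ : ∃ b : ℝ, (b : EReal) = R (Lp.const 1 μ c) :=
    ⟨_, EReal.coe_toReal (hR.const_lt_top c).ne (hR.ne_bot _)⟩
  obtain ⟨r, hr⟩ := hf.exists_norm_le hq.le hq_top.ne ((M - b) / α)
  have hur : ∀ j, ‖u j‖ ≤ r := fun j => hr _ (by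
    have h1 : (b : EReal) ≤ R (reducedCost μ T F x₀ ν a (u j)) :=
      hb ▸ hR.monotone _ _ (hc (u j))
    have h2 : ((b + α * controlCost T f (u j) : ℝ) : EReal) < M := by
      rw [EReal.coe_add]
      exact lt_of_le_of_lt (add_le_add_left h1 _) (huM j)
    rw [le_div_iff₀ hα]
    have := EReal.coe_lt_coe_iff.1 h2
    linarith)
  obtain ⟨v, σ, hσ, hv⟩ := exists_subseq_tendsto_dual hq hq_top.ne hur
  have hweak := tendsto_toWeakSpace_iff.2 hv
  have hvU : v ∈ U := by
    obtain ⟨v', hv', hvv'⟩ := hU_closed.mem_of_tendsto hweak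
      (.of_forall fun j => mem_image_of_mem _ (huU (σ j)))
    rwa [← (toWeakSpace ℝ (ControlSpace T k q)).injective hvv']
  have hrisk : R (reducedCost μ T F x₀ ν a v) ≤
      Filter.liminf (fun j => R (reducedCost μ T F x₀ ν a (u (σ j)))) Filter.atTop :=
    le_liminf_of_forall_lt_eventually fun y hy =>
      (tendsto_reducedCost hT.le hq hq_top.ne hF hp₁.1 hp hx₀ ha (fun j => hur (σ j)) hv).eventually
        (hR.lowerSemicontinuous _ y hy)
  have hcost : ((α * controlCost T f v : ℝ) : EReal) ≤
      Filter.liminf (fun j => ((α * controlCost T f (u (σ j)) : ℝ) : EReal)) Filter.atTop := by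
    refine le_liminf_of_forall_lt_eventually fun y hy => ?_
    obtain ⟨z, hyz, hz⟩ := EReal.lt_iff_exists_real_btwn.1 hy
    have hz' : z / α < controlCost T f v := by
      rw [div_lt_iff₀ hα, mul_comm]; exact EReal.coe_lt_coe_iff.1 hz
    filter_upwards [hf.eventually_lt_of_tendsto hq0 hq_top.ne hweak hz'] with j hj
    refine hyz.trans (EReal.coe_lt_coe_iff.2 ?_)
    rwa [div_lt_iff₀ hα, mul_comm] at hj
  refine ⟨v, hvU, le_antisymm ?_ (iInf₂_le v hvU)⟩
  calc I v ≤ _ := add_le_add hrisk hcost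
    _ ≤ Filter.liminf (fun j => I (u (σ j))) Filter.atTop := EReal.le_liminf_add
    _ = m := (hulim.comp hσ.tendsto_atTop).liminf_eq
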